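/- **Setting.** A *semigroupoid* is a set $G$ with a partially defined multiplication such that, calling $e\in G$ *idempotent* if $ex=x$ whenever $ex$ is defined and $ye=y$ whenever $ye$ is defined: (1) if one of $(ab)c$, $a(bc)$ is defined then so is the other and they are equal, and if $ab$ and $bc$ are defined then so is $(ab)c$; (2) for each $a$ there are idempotents $e,f$ with $ea=a=af$, and $e^2=e$ implies that $e$ is idempotent; (3) if $ab=e$ with $e$ idempotent then $a=b=e$; (4) for each $a$ the set $\{(z,b,w): zbw=a\}$ is finite, and there is $N<\infty$ with $\operatorname{card}\{b: cb=a\}\le N$ for all $a,c\in G$. Write $G_e$ for the set of idempotents and $b\le a$ if $a=zbw$ for some $z,w\in G$. A set $F\subset G$ is *lower* if $a\in F$ and $b\le a$ imply $b\in F$. For a lower set $F$ let $P(F)$ be the space of functions $F\to\mathbb C$ with the product $(f\star g)(a)=\sum_{rs=a}f(r)g(s)$, whose unit is $\delta=\chi_{F\cap G_e}$. For $A,B:F\times F\to\mathbb C$ put $(A\star B)(a,b)=\sum_{pq=a}\sum_{rs=b}A(p,r)B(q,s)$. Let $[1](a,b)=1$ if $a,b$ are both idempotent and $0$ otherwise,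 and let $(ff^*)(a,b)=f(a)\overline{f(b)}$. For $F$ finite let $\mathfrak T(\varphi)$ be the $F\times F$ matrix with entries $[\mathfrak T(\varphi)]_{a,b}=\sum_{cb=a}\varphi(c)$, acting on the Hilbert space $\mathbb C^F$. A nonempty set $\Psi$ of functions $G\to\mathbb C$ is a *collection of test functions* if (a) $\|\mathfrak T(\psi|_F)\|\le1$ for every finite lower set $F$ and $\psi\in\Psi$; (b) for each $a\in G_e$, $\psi(a)^n\to0$ as $n\to\infty$, uniformly in $\psi\in\Psi$; (c) for each finite lower set $F$, the unital algebra generated by $\{\psi|_F:\psi\in\Psi\}$ is all of $P(F)$. A kernel $k:X\times X\to\mathbb C$ is *positive* if each matrix $[k(a,b)]_{a,b\in A}$, $A\subset X$ finite, is positive semidefinite. Let $\mathcal K_\Psi$ be the set of positive kernels $k$ on $G$ for which $([1]-\psi\psi^*)\star k$ is positive for every $\psi\in\Psi$. Let $H^\infty(\mathcal K_\Psi)$ be the set of functions $\varphi:G\to\mathbb C$ for which there is $C>0$ such that $(C^2[1]-\varphi\varphi^*)\star k$ is positive for all $k\in\mathcal K_\Psi$; the norm $\|\varphi\|_{H^\infty(\mathcal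 K_\Psi)}$ is the infimum of all such $C$. Let $\mathfrak B=C_b(\Psi)$ be the $C^*$-algebra of bounded continuous functions on $\Psi$, where $\Psi$ has the topology of pointwise convergence, and let $E(x)\in\mathfrak B$ be the evaluation $E(x)(\psi)=\psi(x)$, $x\in G$. A function $\Gamma:F\times F\to\mathfrak B^*$ is a *positive kernel* if $\sum_{x,y\in A}\Gamma(x,y)(g(x)g(y)^*)\ge0$ for all finite $A\subset F$ and $g:A\to\mathfrak B$, and $$(\Gamma\,\hat\star\,([1]-EE^*))(x,y)=\sum_{pq=x}\sum_{rs=y}\Gamma(q,s)\big([1](p,r)1-E(p)E(r)^*\big).$$ **Theorem (Agler–Jury–Pick interpolation).** Let $\Psi$ be a collection of test functions for the semigroupoid $G$, let $F\subset G$ be a finite lower set and let $f\in P(F)$. The following are equivalent: (i) there is $\varphi\in H^\infty(\mathcal K_\Psi)$ with $\|\varphi\|_{H^\infty(\mathcal K_\Psi)}\le1$ and $\varphi|_F=f$; (ii) for each $k\in\mathcal K_\Psi$ the kernel $F\times F\ni(x,y)\mapsto(([1]-ff^*)\star k)(x,y)$ is positive; (iii) there is a positive kernel $\Gamma:F\times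 F\to\mathfrak B^*$ with $([1]-ff^*)(x,y)=(\Gamma\,\hat\star\,([1]-EE^*))(x,y)$ for all $x,y\in F$. Moreover, every $f\in P(F)$ is the restriction of some $\varphi\in H^\infty(\mathcal K_\Psi)$, and the quotient norm of $f$, $\inf\{\|\varphi\|_{H^\infty(\mathcal K_\Psi)}:\varphi\in H^\infty(\mathcal K_\Psi),\ \varphi|_F=f\}$, equals the infimum of all $C>0$ such that $(C^2[1]-ff^*)\star k$ is positive on $F\times F$ for every $k\in\mathcal K_\Psi$. -/

import Mathlib

open scoped ComplexOrder BoundedContinuousFunction Topology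

namespace AglerJury

/-- A partial multiplication, given by its graph: `IsProd a b c` says that the product `ab` is
defined and equals `c`. -/
class PartialMul (α : Type*) where
  IsProd : α → α → α → Prop

open PartialMul

/-- A subset inherits the partial multiplication: `xy = z` for elements of the subset. -/
instance {α : Type*} [PartialMul α] (p : α → Prop) : PartialMul {x : α // p x} where
  IsProd x y z := IsProd (x : α) (y : α) (z : α)

/-- `e` is idempotent: `ex = x` whenever `ex` is defined, and `ye = y` whenever `ye` is defined. -/
def IsIdem {α : Type*} [PartialMul α] (e : α) : Prop :=
  (∀ x y : α, IsProd e x y → y = x) ∧ (∀ x y : α, IsProd x e y → y = x)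

/-- Semigroupoids. -/
class Semigroupoid (G : Type*) extends PartialMul G where
  /-- the multiplication is a (partial) function -/
  isProd_unique : ∀ a b c d : G, IsProd a b c → IsProd a b d → c = d
  /-- if one of `(ab)c`, `a(bc)` is defined, then so is the other and they are equal -/
  assoc : ∀ a b c d : G,
    (∃ x, IsProd a b x ∧ IsProd x c d) ↔ (∃ y, IsProd b c y ∧ IsProd a y d)
  /-- if `ab` and `bc` are defined, then so is `(ab)c` -/
  isProd_of_isProd : ∀ a b c x y : G, IsProd a b x → IsProd b c y → ∃ d, IsProd x c d
  /-- existence of idempotents -/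
  exists_idem : ∀ a : G, ∃ e f : G, IsIdem e ∧ IsIdem f ∧ IsProd e a a ∧ IsProd a f a
  isIdem_of_sq : ∀ e : G, IsProd e e e → IsIdem e
  /-- nonexistence of inverses -/
  no_inverses : ∀ a b e : G, IsIdem e → IsProd a b e → a = e ∧ b = e
  /-- strong artinian law, first part: `zbw = a` has finitely many solutions `(z, b, w)` -/
  artinian : ∀ a : G, {t : G × G × G | ∃ x, IsProd t.1 t.2.1 x ∧ IsProd x t.2.2 a}.Finite
  /-- strong artinian law, second part: a uniform bound on the number of `b` with `cb = a` -/
  artinian_unif : ∃ N : ℕ, ∀ a c : G, {b : G | IsProd c b a}.encard ≤ N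

/-- The order: `b ≤ a` if and only if `a = zbw` for some `z, w`. -/
def Below {G : Type*} [PartialMul G] (b a : G) : Prop :=
  ∃ z w x : G, IsProd z b x ∧ IsProd x w a

/-- Lower sets. -/
def IsLower {G : Type*} [PartialMul G] (F : Set G) : Prop :=
  ∀ a ∈ F, ∀ b, Below b a → b ∈ F

/-- The pairs `(p, q)` with `pq = a`. -/
def factorizations {α : Type*} [PartialMul α] (a : α) : Set (α × α) :=
  {t | IsProd t.1 t.2 a}

/-- The sums over factorizations below are finite sums: over a semigroupoid by this fact, over a
finite lower set trivially. -/
theorem factorizations_finite {G : Type*} [Semigroupoid G] (a : G) :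
    (factorizations a).Finite := by
  refine Set.Finite.of_finite_image (f := fun t : G × G =>
    (t.1, (Classical.choose (Semigroupoid.exists_idem t.1).choose_spec), t.2)) ?_ ?_
  · refine (Semigroupoid.artinian a).subset ?_
    rintro _ ⟨t, ht, rfl⟩
    exact ⟨t.1, (Classical.choose_spec (Semigroupoid.exists_idem t.1).choose_spec).2.2.2, ht⟩
  · rintro ⟨p, q⟩ _ ⟨p', q'⟩ _ h
    simp only [Prod.mk.injEq] at h
    exact Prod.ext h.1 h.2.2

/-- The convolution product of functions, `(f ⋆ g)(a) = ∑_{pq = a} f(p) g(q)`. -/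
noncomputable def conv {α : Type*} [PartialMul α] (f g : α → ℂ) (a : α) : ℂ :=
  ∑ᶠ t ∈ factorizations a, f t.1 * g t.2

/-- The bivariate product, `(A ⋆ B)(a, b) = ∑_{pq = a} ∑_{rs = b} A(p, r) B(q, s)`. -/
noncomputable def starProd {α : Type*} [PartialMul α] (A B : α → α → ℂ) (a b : α) : ℂ :=
  ∑ᶠ t ∈ factorizations a, ∑ᶠ u ∈ factorizations b, A t.1 u.1 * B t.2 u.2

/-- The product `(Γ ⋆̂ B)(a, b) = ∑_{pq = a} ∑_{rs = b} Γ(q, s)(B(p, r))` of a kernel with values in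
the dual of `𝔅` and a kernel with values in `𝔅`. -/
noncomputable def starHat {α 𝔅 : Type*} [PartialMul α] [NormedAddCommGroup 𝔅] [NormedSpace ℂ 𝔅]
    (Γ : α → α → StrongDual ℂ 𝔅) (B : α → α → 𝔅) (a b : α) : ℂ :=
  ∑ᶠ t ∈ factorizations a, ∑ᶠ u ∈ factorizations b, Γ t.2 u.2 (B t.1 u.1)

open Classical in
/-- The unit `δ` for the convolution product. -/
noncomputable def delta {G : Type*} [PartialMul G] (a : G) : ℂ := if IsIdem a then 1 else 0

open Classical in
/-- The matrix `[1]`. -/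
noncomputable def unitKer {G : Type*} [PartialMul G] (a b : G) : ℂ :=
  if IsIdem a ∧ IsIdem b then 1 else 0

/-- The (left) Toeplitz representation, `𝔗(φ)_{a,b} = ∑_{cb = a} φ(c)`. -/
noncomputable def toeplitz {α : Type*} [PartialMul α] (φ : α → ℂ) : Matrix α α ℂ :=
  Matrix.of fun a b => ∑ᶠ c ∈ {c : α | IsProd c b a}, φ c

open Classical in
/-- The operator norm of `𝔗(φ)` on the Hilbert space `ℂ^F`, for `φ` a function on the finite set
`F`. -/
noncomputable def toeplitzNorm {G : Type*} [PartialMul G] (F : Finset G) (φ : F → ℂ) : ℝ :=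
  ‖Matrix.toEuclideanCLM (n := F) (𝕜 := ℂ) (toeplitz φ)‖

/-- Collections of test functions. In `tendsto_zero` the `n`-fold `⋆`-power of `ψ` at an idempotent
`a` is just `ψ(a) ^ n`. In `generates`, the unital algebra (for `⋆`) generated by the restrictions
to `F` of the members of `Ψ` is the algebra of all functions on `F`. -/
structure IsTestFamily {G : Type*} [Semigroupoid G] (Ψ : Set (G → ℂ)) : Prop where
  contractive : ∀ F : Finset G, IsLower (F : Set G) → ∀ ψ ∈ Ψ,
    toeplitzNorm F (fun x => ψ x) ≤ 1
  tendsto_zero : ∀ a : G, IsIdem a →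
    TendstoUniformlyOn (fun (n : ℕ) (ψ : G → ℂ) => ψ a ^ n) (fun _ => 0) Filter.atTop Ψ
  generates : ∀ F : Finset G, IsLower (F : Set G) → ∀ S : Submodule ℂ (F → ℂ),
    (fun x : F => delta (x : G)) ∈ S → (∀ ψ ∈ Ψ, (fun x : F => ψ x) ∈ S) →
    (∀ f ∈ S, ∀ g ∈ S, conv f g ∈ S) → S = ⊤

/-- Positive kernels with values in `ℂ`. -/
def IsPosKernel {α : Type*} (k : α → α → ℂ) : Prop :=
  ∀ A : Finset α, (Matrix.of fun a b : A => k a b).PosSemidef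

/-- Positive kernels with values in the dual of a (unital) C⋆-algebra. -/
def IsPosDualKernel {α 𝔅 : Type*} [CStarAlgebra 𝔅] (Γ : α → α → StrongDual ℂ 𝔅) : Prop :=
  ∀ (A : Finset α) (f : α → 𝔅), 0 ≤ ∑ x ∈ A, ∑ y ∈ A, Γ x y (f x * star (f y))

/-- The family of kernels `𝒦_Ψ`. -/
def kernels {G : Type*} [PartialMul G] (Ψ : Set (G → ℂ)) : Set (G → G → ℂ) :=
  {k | IsPosKernel k ∧ ∀ ψ ∈ Ψ,
    IsPosKernel (starProd (fun p q => unitKer p q - ψ p * star (ψ q)) k)}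

/-- The constants `C > 0` for which `(C²[1] - φφ*) ⋆ k` is positive for all `k` in `𝒦_Ψ`. -/
def hInftyBounds {G : Type*} [PartialMul G] (Ψ : Set (G → ℂ)) (φ : G → ℂ) : Set ℝ :=
  {C | 0 < C ∧ ∀ k ∈ kernels Ψ,
    IsPosKernel (starProd (fun p q => (C : ℂ) ^ 2 * unitKer p q - φ p * star (φ q)) k)}

/-- `φ ∈ H^∞(𝒦_Ψ)`. -/
def MemHInfty {G : Type*} [PartialMul G] (Ψ : Set (G → ℂ)) (φ : G → ℂ) : Prop :=
  (hInftyBounds Ψ φ).Nonempty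

/-- The norm of `H^∞(𝒦_Ψ)`. -/
noncomputable def hInftyNorm {G : Type*} [PartialMul G] (Ψ : Set (G → ℂ)) (φ : G → ℂ) : ℝ :=
  sInf (hInftyBounds Ψ φ)

/-- The quotient norm on the functions on `F`: the infimum of the norms of the extensions of `f` to
members of `H^∞(𝒦_Ψ)`. -/
noncomputable def quotientNorm {G : Type*} [PartialMul G] (Ψ : Set (G → ℂ)) (F : Finset G)
    (f : F → ℂ) : ℝ :=
  sInf {r | ∃ φ : G → ℂ, MemHInfty Ψ φ ∧ (∀ x : F, φ x = f x) ∧ hInftyNorm Ψ φ = r}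

/-- The norm on the functions on `F` that is computed by the kernels: the infimum of the `C > 0` such
that `(C²[1] - ff*) ⋆ k` is positive on `F × F` for all `k` in `𝒦_Ψ`. -/
noncomputable def kernelNorm {G : Type*} [PartialMul G] (Ψ : Set (G → ℂ)) (F : Finset G)
    (f : F → ℂ) : ℝ :=
  sInf {C : ℝ | 0 < C ∧ ∀ k ∈ kernels Ψ,
    IsPosKernel (starProd
      (fun p q : F => (C : ℂ) ^ 2 * unitKer (p : G) (q : G) - f p * star (f q))
      (fun p q : F => k p q))}

theorem Below.trans {G : Type*} [Semigroupoid G] {a b c : G} (h₁ : Below a b) (h₂ : Below b c) :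
    Below a c := by
  obtain ⟨z, w, u, hzu, huw⟩ := h₁
  obtain ⟨z', w', v, hv, hx⟩ := h₂
  obtain ⟨m, hm, hmv⟩ := (Semigroupoid.assoc z' u w v).2 ⟨b, huw, hv⟩
  obtain ⟨n, hn, hnm⟩ := (Semigroupoid.assoc z' z a m).2 ⟨u, hzu, hm⟩
  obtain ⟨y, _, hy⟩ := (Semigroupoid.assoc m w w' c).1 ⟨v, hmv, hx⟩
  exact ⟨n, y, m, hnm, hy⟩

theorem finite_below {G : Type*} [Semigroupoid G] (a : G) : {b : G | Below b a}.Finite := by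
  refine ((Semigroupoid.artinian a).image fun t => t.2.1).subset ?_
  rintro b ⟨z, w, x, h⟩
  exact ⟨(z, b, w), ⟨x, h⟩, rfl⟩

theorem IsTestFamily.norm_le_one {G : Type*} [Semigroupoid G] {Ψ : Set (G → ℂ)}
    (h : IsTestFamily Ψ) {ψ : G → ℂ} (hψ : ψ ∈ Ψ) (x : G) : ‖ψ x‖ ≤ 1 := by
  classical
  obtain ⟨e, f, he, hf, hex, hxf⟩ := Semigroupoid.exists_idem x
  have hmem : ∀ b, b ∈ (finite_below x).toFinset ↔ Below b x := by simp
  set F : Finset G := (finite_below x).toFinset with hFdef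
  have hF : IsLower (F : Set G) := fun a ha b hb =>
    (hmem b).2 (hb.trans ((hmem a).1 ha))
  have hxF : x ∈ F := (hmem x).2 ⟨e, f, x, hex, hxf⟩
  obtain ⟨e', f', -, -, -, hff⟩ := Semigroupoid.exists_idem f
  have hfF : f ∈ F := (hmem f).2 ⟨x, f', x, hxf, by
    have h1 : f' = f := ((hf.1 _ _ hff)).symm
    rw [h1]; exact hxf⟩
  have hle := h.contractive F hF ψ hψ
  have hentry : toeplitz (fun y : F => ψ y) ⟨x, hxF⟩ ⟨f, hfF⟩ = ψ x := by
    have hs : {c : F | PartialMul.IsProd c (⟨f, hfF⟩ : F) (⟨x, hxF⟩ : F)} = {⟨x, hxF⟩} := by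
      ext c
      constructor
      · intro hc
        exact Subtype.ext (hf.2 _ _ hc).symm
      · rintro rfl
        exact hxf
    simp only [toeplitz, Matrix.of_apply, hs, finsum_mem_singleton]
  set T := Matrix.toEuclideanCLM (n := F) (𝕜 := ℂ) (toeplitz (fun y : F => ψ y)) with hT
  have h1 := T.le_opNorm (EuclideanSpace.single ⟨f, hfF⟩ 1)
  have h2 := PiLp.norm_apply_le (T (EuclideanSpace.single ⟨f, hfF⟩ 1)) ⟨x, hxF⟩
  have h3 : T (EuclideanSpace.single ⟨f, hfF⟩ 1) ⟨x, hxF⟩ = ψ x := by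
    rw [← hentry, hT]
    simp [EuclideanSpace.single]
  rw [h3] at h2
  have h4 : ‖T‖ ≤ 1 := by
    have h5 := hle
    unfold toeplitzNorm at h5
    convert h5 using 3
  simp only [PiLp.norm_single, norm_one, mul_one] at h1
  linarith

/-- The evaluation `E(x)(ψ) = ψ(x)`, an element of the C⋆-algebra `𝔅` of bounded continuous functions
on `Ψ`, where `Ψ` carries the topology of pointwise convergence. -/
noncomputable def evalE {G : Type*} [Semigroupoid G] {Ψ : Set (G → ℂ)} (h : IsTestFamily Ψ)
    (x : G) : Ψ →ᵇ ℂ :=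
  BoundedContinuousFunction.ofNormedAddCommGroup (fun ψ : Ψ => (ψ : G → ℂ) x)
    ((continuous_apply x).comp continuous_subtype_val) 1 (fun ψ => h.norm_le_one ψ.2 x)

end AglerJury

open AglerJury

/-! On a finite lower set `F` the functions form a finite-dimensional unital algebra whose left
regular representation is `f ↦ toeplitz f`, and `([1] - ff*) ⋆ k` is the matrix `k - T_f k T_f*`. By
Schur complements, `k - T k T* ≥ 0` is the same as `L - T* L T ≥ 0` for `L = k⁻¹`
(`posSemidef_sub_conj_iff`). Everything is therefore phrased with the cone of positive forms `L`
decreased by all `T_ψ`, and with the ball of those `f` with `L(f) ≤ L(δ)` on this cone. Each of the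
three conditions turns out to be membership of `f` in the ball.

Kernels: the cone is stable under right multiplications, so the inequality at `δ` already gives `L -
T_f* L T_f ≥ 0`. Conversely `(L + ε)⁻¹` on `F`, continued by `ε⁻¹` on the diagonal off `F`, is a
kernel in `𝒦_Ψ` (`extKernel_mem_kernels`). Hence the kernel condition on `F` only sees the cone
(`forall_kernels_iff_mem_ball`).

Extension (`exists_extension`): if `f` in the ball of `F` were not a restriction from the ball of
`F' ⊇ F`, Hahn–Banach would give a functional `u` on functions on `F` that is bounded by one on
restrictions but larger than one at `f`. A second separation (`exists_dominating`) dominates `|u|²`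
by a form `L` in the cone of `F'` with `L(δ) ≤ 1`. For the kernel `k = (L + ε)⁻¹` this says `k(u,u)
≤ 1`, so `k(T_f*u, T_f*u) ≤ 1`, and Cauchy–Schwarz for `⟨u, f⟩ = ⟨T_f*u, δ⟩` gives a contradiction
as `ε → 0`. Tychonoff compactness then reaches all of `G`; scaling gives the equality of norms.

Dual kernels: the trace pairing of `L` with `Γ ⋆̂ ([1] - EE*)` is `Γ` applied to `ψ ↦ L - T_ψ* L
T_ψ`, so the matrices of this shape form the polar of the cone, provided that they are a closed set
and that `L - T_ψ* L T_ψ ≥ 0` forces `L ≥ 0`. Both follow from `exists_strict_form`: the `T_ψ` are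
triangular for divisibility, with diagonal entries uniformly below one in modulus, so one weighted
norm makes all of them uniformly strict contractions. -/

namespace AglerJury
open PartialMul Matrix
open scoped Classical

/-! ### Idempotents and divisibility in a semigroupoid. -/

section Semigroupoid
variable {G : Type*} [Semigroupoid G]

theorem IsIdem.left_unique {a e e' : G} (he : IsIdem e) (he' : IsIdem e')
    (h : IsProd e a a) (h' : IsProd e' a a) : e = e' := by
  obtain ⟨d, hd, -⟩ := (Semigroupoid.assoc e e' a a).2 ⟨a, h', h⟩
  rw [← he'.2 _ _ hd, he.1 _ _ hd]

theorem IsIdem.right_unique {a e e' : G} (he : IsIdem e) (he' : IsIdem e')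
    (h : IsProd a e a) (h' : IsProd a e' a) : e = e' := by
  obtain ⟨d, hd, -⟩ := (Semigroupoid.assoc a e e' a).1 ⟨a, h, h'⟩
  rw [← he'.2 _ _ hd, he.1 _ _ hd]

/-- An element with a left fixed point is idempotent. -/
theorem isIdem_of_isProd_self {p x : G} (h : IsProd p x x) : IsIdem p := by
  let S := {z : G // IsProd z x x}
  obtain ⟨-, f, -, -, -, hf⟩ := Semigroupoid.exists_idem x
  have hfin : {z : G | IsProd z x x}.Finite := by
    refine ((Semigroupoid.artinian x).image fun t => t.1).subset ?_
    intro z hz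
    exact ⟨(z, x, f), ⟨x, hz, hf⟩, rfl⟩
  have hmul : ∀ a b : S, ∃ c : S, IsProd (a : G) b c := by
    rintro ⟨a, ha⟩ ⟨b, hb⟩
    obtain ⟨c, hc, hcx⟩ := (Semigroupoid.assoc a b x x).2 ⟨x, hb, ha⟩
    exact ⟨⟨c, hcx⟩, hc⟩
  choose m hm using hmul
  let _ : Semigroup S :=
    { mul := m
      mul_assoc := fun a b c => by
        apply Subtype.ext
        obtain ⟨y, hy, hy'⟩ := (Semigroupoid.assoc (a : G) b c _).1 ⟨_, hm a b, hm (m a b) c⟩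
        have := Semigroupoid.isProd_unique _ _ _ _ hy (hm b c)
        subst this
        exact Semigroupoid.isProd_unique _ _ _ _ hy' (hm a (m b c)) }
  have : Finite S := hfin
  let _ : TopologicalSpace S := ⊥
  have : DiscreteTopology S := ⟨rfl⟩
  let p' : S := ⟨p, h⟩
  -- The left stabilizer of `x` is a finite semigroup, so its right ideal `p' * S` contains an
  -- idempotent `e = ps`; the absence of inverses then forces `p = e`.
  obtain ⟨e, ⟨s, hs⟩, he⟩ := exists_idempotent_in_compact_subsemigroup
    (fun r : S => continuous_of_discreteTopology) (Set.range fun s : S => p' * s)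
    ⟨_, Set.mem_range_self p'⟩ (Set.toFinite _).isCompact (by
      rintro _ ⟨s, rfl⟩ _ ⟨t, rfl⟩
      exact ⟨s * (p' * t), by simp only [mul_assoc]⟩)
  have h1 : IsProd (e : G) e e := by
    have := hm e e
    rwa [show m e e = e from he] at this
  have h2 : IsProd (p : G) s e := by
    have := hm p' s
    rwa [show m p' s = e from hs] at this
  have h3 := Semigroupoid.isIdem_of_sq _ h1
  rw [(Semigroupoid.no_inverses _ _ _ h3 h2).1]
  exact h3

/-- Left divisibility is antisymmetric. -/
theorem eq_of_isProd_of_isProd {a b c d : G} (h : IsProd c b a) (h' : IsProd d a b) : a = b := by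
  -- The product `u = dc` fixes `b`, so it is idempotent; hence `c = u`, and `cb = a` collapses to
  -- `b`.
  obtain ⟨u, hu, hub⟩ := (Semigroupoid.assoc d c b b).2 ⟨a, h, h'⟩
  have hui := isIdem_of_isProd_self hub
  have hc := (Semigroupoid.no_inverses _ _ _ hui hu).2
  exact hui.1 _ _ (hc ▸ h)

theorem IsProd.below_left {p q a : G} (h : IsProd p q a) : Below p a := by
  obtain ⟨e, -, -, -, he, -⟩ := Semigroupoid.exists_idem p
  exact ⟨e, q, p, he, h⟩

theorem IsProd.below_right {p q a : G} (h : IsProd p q a) : Below q a := by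
  obtain ⟨-, f, -, -, -, hf⟩ := Semigroupoid.exists_idem a
  exact ⟨p, f, a, h, hf⟩

/-- Every finite set is contained in a finite lower set. -/
theorem exists_isLower_superset (A : Finset G) :
    ∃ F : Finset G, A ⊆ F ∧ IsLower (F : Set G) := by
  refine ⟨A.biUnion fun a => (finite_below a).toFinset, ?_, ?_⟩
  · intro a ha
    obtain ⟨e, f, -, -, he, hf⟩ := Semigroupoid.exists_idem a
    exact Finset.mem_biUnion.2 ⟨a, ha, by simpa using ⟨e, f, a, he, hf⟩⟩
  · intro a ha b hb
    simp only [Finset.mem_coe, Finset.mem_biUnion, Set.Finite.mem_toFinset] at ha ⊢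
    obtain ⟨c, hc, hac⟩ := ha
    exact ⟨c, hc, hb.trans hac⟩

theorem IsLower.union {F F' : Set G} (hF : IsLower F) (hF' : IsLower F') :
    IsLower (F ∪ F') := by
  rintro a (ha | ha) b hb
  exacts [Or.inl (hF a ha b hb), Or.inr (hF' a ha b hb)]

end Semigroupoid

/-! ### The Toeplitz representation and the bivariate product on finite lower sets. -/

section Toeplitz
variable {G : Type*} [Semigroupoid G] {F : Finset G}

theorem toeplitz_apply (f : F → ℂ) (a b : F) :
    toeplitz f a b = ∑ c : F, if IsProd (c : G) b a then f c else 0 := by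
  rw [toeplitz, Matrix.of_apply, finsum_mem_eq_finite_toFinset_sum _ (Set.toFinite _),
    ← Finset.sum_filter]
  congr 1
  ext c
  simp
  rfl

/-- The Toeplitz representation as a linear map. -/
noncomputable def toeplitzLin (F : Finset G) : (F → ℂ) →ₗ[ℂ] Matrix F F ℂ where
  toFun := toeplitz
  map_add' f g := by
    ext a b
    simp only [toeplitz_apply, Matrix.add_apply, Pi.add_apply, ← Finset.sum_add_distrib]
    exact Finset.sum_congr rfl fun c _ => by split_ifs <;> simp
  map_smul' r f := by
    ext a b
    simp only [toeplitz_apply, Matrix.smul_apply, Pi.smul_apply, smul_eq_mul, Finset.mul_sum,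
      RingHom.id_apply]
    exact Finset.sum_congr rfl fun c _ => by split_ifs <;> simp

theorem sum_factorizations {M : Type*} [AddCommMonoid M] (a : F) (φ : F × F → M) :
    ∑ᶠ t ∈ factorizations a, φ t
      = ∑ q : F, ∑ p : F, if IsProd (p : G) q a then φ (p, q) else 0 := by
  rw [finsum_mem_eq_finite_toFinset_sum _ (Set.toFinite _), Finset.sum_comm,
    ← Finset.sum_product', ← Finset.sum_filter]
  refine Finset.sum_congr ?_ fun _ _ => rfl
  ext t
  simp [factorizations]
  rfl

theorem conv_eq_mulVec (f g : F → ℂ) : conv f g = toeplitz f *ᵥ g := by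
  ext a
  rw [conv, sum_factorizations, mulVec, dotProduct]
  refine Finset.sum_congr rfl fun q _ => ?_
  rw [toeplitz_apply, Finset.sum_mul]
  exact Finset.sum_congr rfl fun p _ => by split_ifs <;> simp

/-- Associativity: both entries sum `f p * g q` over the pairs with `(pq)b = a`, respectively `p(qb)
= a`. Lowerness keeps the intermediate products in `F`. -/
theorem toeplitz_mulVec (hF : IsLower (F : Set G)) (f g : F → ℂ) :
    toeplitz (toeplitz f *ᵥ g) = toeplitz f * toeplitz g := by
  ext a b
  simp only [toeplitz_apply, mul_apply, mulVec, dotProduct, Finset.sum_mul_sum]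
  have h1 : ∀ c : F, (if IsProd (c : G) b a then
        ∑ q : F, (∑ p : F, if IsProd (p : G) q c then f p else 0) * g q else 0)
      = ∑ q : F, ∑ p : F, if IsProd (c : G) b a ∧ IsProd (p : G) q c then f p * g q else 0 := by
    intro c
    split_ifs with h
    · refine Finset.sum_congr rfl fun q _ => ?_
      rw [Finset.sum_mul]
      exact Finset.sum_congr rfl fun p _ => by simp [h]
    · simp [h]
  have h2 : ∀ d p q : F, (if IsProd (p : G) d a then f p else 0) *
      (if IsProd (q : G) b d then g q else 0)
      = if IsProd (p : G) d a ∧ IsProd (q : G) b d then f p * g q else 0 := by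
    intro d p q
    split_ifs <;> simp_all
  simp only [h1, h2]
  have h3 : ∀ X : F → F → F → ℂ, ∑ c, ∑ q, ∑ p, X c q p = ∑ q, ∑ p, ∑ c, X c q p := fun X => by
    rw [Finset.sum_comm]
    exact Finset.sum_congr rfl fun q _ => Finset.sum_comm
  have h4 : ∀ X : F → F → F → ℂ, ∑ d, ∑ p, ∑ q, X d p q = ∑ q, ∑ p, ∑ d, X d p q := fun X => by
    rw [h3, Finset.sum_comm]
  refine (h3 _).trans (Eq.trans ?_ (h4 _).symm)
  refine Finset.sum_congr rfl fun q _ => Finset.sum_congr rfl fun p _ => ?_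
  by_cases h : ∃ x : G, IsProd (p : G) q x ∧ IsProd x b (a : G)
  · obtain ⟨x, hx, hxa⟩ := h
    obtain ⟨y, hy, hya⟩ := (Semigroupoid.assoc (p : G) q b a).1 ⟨x, hx, hxa⟩
    have hxF : x ∈ F := hF a a.2 x (IsProd.below_left hxa)
    have hyF : y ∈ F := hF a a.2 y (IsProd.below_right hya)
    rw [Finset.sum_eq_single ⟨x, hxF⟩, Finset.sum_eq_single ⟨y, hyF⟩]
    · simp [hx, hxa, hy, hya]
    · intro d _ hd
      rw [if_neg]
      rintro ⟨-, h⟩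
      exact hd (Subtype.ext (Semigroupoid.isProd_unique _ _ _ _ h hy))
    · simp
    · intro d _ hd
      rw [if_neg]
      rintro ⟨-, h⟩
      exact hd (Subtype.ext (Semigroupoid.isProd_unique _ _ _ _ h hx))
    · simp
  · rw [Finset.sum_eq_zero, Finset.sum_eq_zero]
    · intro d _
      rw [if_neg]
      rintro ⟨h1, h2⟩
      exact h ((Semigroupoid.assoc (p : G) q b a).2 ⟨d, h2, h1⟩)
    · intro d _
      rw [if_neg]
      rintro ⟨h1, h2⟩
      exact h ⟨d, h2, h1⟩

theorem toeplitz_delta (hF : IsLower (F : Set G)) :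
    toeplitz (fun x : F => delta (x : G)) = 1 := by
  ext a b
  rw [toeplitz_apply]
  obtain ⟨e, -, he, -, hea, -⟩ := Semigroupoid.exists_idem (a : G)
  by_cases hab : a = b
  · subst hab
    rw [Matrix.one_apply_eq, Finset.sum_eq_single ⟨e, hF a a.2 e (IsProd.below_left hea)⟩]
    · simp [hea, delta, he]
    · intro c _ hc
      split_ifs with h
      · rw [delta, if_neg]
        intro hci
        exact hc (Subtype.ext (hci.left_unique he h hea))
      · rfl
    · simp
  · rw [Matrix.one_apply_ne hab]
    refine Finset.sum_eq_zero fun c _ => ?_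
    split_ifs with h
    · rw [delta, if_neg]
      intro hci
      exact hab (Subtype.ext (hci.1 _ _ h))
    · rfl

theorem toeplitz_mulVec_delta (hF : IsLower (F : Set G)) (f : F → ℂ) :
    toeplitz f *ᵥ (fun x : F => delta (x : G)) = f := by
  ext a
  obtain ⟨-, e, -, he, -, hae⟩ := Semigroupoid.exists_idem (a : G)
  simp only [mulVec, dotProduct, toeplitz_apply]
  rw [Finset.sum_eq_single ⟨e, hF a a.2 e (IsProd.below_right hae)⟩,
    Finset.sum_eq_single a]
  · simp [hae, delta, he]
  · intro c _ hc
    rw [if_neg]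
    intro h
    exact hc (Subtype.ext (he.2 _ _ h).symm)
  · simp
  · intro b _ hb
    by_cases hbi : IsIdem (b : G)
    · rw [Finset.sum_eq_zero, zero_mul]
      intro c _
      rw [if_neg]
      intro h
      have := hbi.2 _ _ h
      rw [← this] at h
      exact hb (Subtype.ext (hbi.right_unique he h hae))
    · simp [delta, hbi]
  · simp

/-- For fixed right factors `q`, `s` the sums over the left factors separate, and each is a Toeplitz
entry. -/
theorem starProd_rankOne (φ φ' : F → ℂ) (k : F → F → ℂ) (a b : F) :
    starProd (fun p q => φ p * star (φ' q)) k a b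
      = (toeplitz φ * Matrix.of k * (toeplitz φ')ᴴ) a b := by
  have hr : (toeplitz φ * Matrix.of k * (toeplitz φ')ᴴ) a b
      = ∑ q : F, ∑ s : F, toeplitz φ a q * k q s * star (toeplitz φ' b s) := by
    simp only [mul_apply, Finset.sum_mul, conjTranspose_apply, Matrix.of_apply]
    exact Finset.sum_comm
  rw [hr]
  simp only [starProd, sum_factorizations, toeplitz_apply]
  refine Finset.sum_congr rfl fun q _ => ?_
  have h : ∀ s : F, ∑ p : F, (if IsProd (p : G) q a then φ p else 0) * k q s *
      star (∑ r : F, if IsProd (r : G) s b then φ' r else 0) =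
      ∑ p : F, ∑ r : F, if IsProd (p : G) q a then
        if IsProd (r : G) s b then φ p * star (φ' r) * k q s else 0 else 0 := fun s => by
    simp only [star_sum, Finset.mul_sum]
    refine Finset.sum_congr rfl fun p _ => Finset.sum_congr rfl fun r _ => ?_
    split_ifs <;> simp
    ring
  trans ∑ s : F, ∑ p : F, (if IsProd (p : G) q a then φ p else 0) * k q s *
      star (∑ r : F, if IsProd (r : G) s b then φ' r else 0)
  · simp only [h]
    rw [Finset.sum_comm]
    refine Finset.sum_congr rfl fun p _ => ?_
    split_ifs <;> simp
  · simp only [Finset.sum_mul]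

theorem starProd_sub (A B k : F → F → ℂ) (a b : F) :
    starProd (fun p q => A p q - B p q) k a b = starProd A k a b - starProd B k a b := by
  simp only [starProd, sum_factorizations, ← Finset.sum_sub_distrib]
  refine Finset.sum_congr rfl fun q _ => Finset.sum_congr rfl fun p _ => ?_
  split_ifs
  · simp only [← Finset.sum_sub_distrib]
    refine Finset.sum_congr rfl fun s _ => Finset.sum_congr rfl fun r _ => ?_
    split_ifs <;> simp [sub_mul]
  · simp

theorem starProd_smul (c : ℂ) (A k : F → F → ℂ) (a b : F) :
    starProd (fun p q => c * A p q) k a b = c * starProd A k a b := by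
  simp only [starProd, sum_factorizations, Finset.mul_sum]
  refine Finset.sum_congr rfl fun q _ => Finset.sum_congr rfl fun p _ => ?_
  split_ifs
  · simp only [Finset.mul_sum]
    refine Finset.sum_congr rfl fun s _ => Finset.sum_congr rfl fun r _ => ?_
    split_ifs <;> simp [mul_assoc]
  · simp

theorem unitKer_eq (p q : G) : unitKer p q = delta p * star (delta q) := by
  unfold unitKer delta
  by_cases hp : IsIdem p <;> by_cases hq : IsIdem q <;> simp [hp, hq]

/-- On a finite lower set the `⋆`-product with `c[1] - φφ*` is `k ↦ ck - 𝔗(φ)k𝔗(φ)*`. -/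
theorem starProd_unitKer_sub (hF : IsLower (F : Set G)) (c : ℂ) (φ : F → ℂ) (k : F → F → ℂ) :
    Matrix.of (starProd (fun p q : F => c * unitKer (p : G) (q : G) - φ p * star (φ q)) k)
      = c • Matrix.of k - toeplitz φ * Matrix.of k * (toeplitz φ)ᴴ := by
  ext a b
  rw [Matrix.of_apply, starProd_sub, starProd_smul, starProd_rankOne]
  simp only [unitKer_eq]
  rw [starProd_rankOne (fun p : F => delta (p : G)) (fun p : F => delta (p : G)),
    toeplitz_delta hF]
  simp

/-- The `⋆`-product of kernels on `G` restricts to finite lower sets. -/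
theorem starProd_restrict (hF : IsLower (F : Set G)) (A k : G → G → ℂ) (a b : F) :
    starProd A k (a : G) b = starProd (fun p q : F => A p q) (fun p q : F => k p q) a b := by
  have key : ∀ (a : F) (φ : G × G → ℂ), ∑ᶠ t ∈ factorizations (a : G), φ t
      = ∑ᶠ t ∈ factorizations a, φ ((t.1 : G), (t.2 : G)) := by
    intro a φ
    have himg : factorizations (a : G)
        = (fun t : F × F => ((t.1 : G), (t.2 : G))) '' factorizations a := by
      ext ⟨p, q⟩
      constructor
      · intro h
        exact ⟨(⟨p, hF a a.2 p (IsProd.below_left h)⟩, ⟨q, hF a a.2 q (IsProd.below_right h)⟩),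
          h, rfl⟩
      · rintro ⟨t, ht, h⟩
        rw [← h]
        exact ht
    rw [himg, finsum_mem_image]
    rintro ⟨p, q⟩ _ ⟨p', q'⟩ _ h
    simp only [Prod.mk.injEq] at h
    exact Prod.ext (Subtype.ext h.1) (Subtype.ext h.2)
  simp only [starProd]
  rw [key]
  refine finsum_mem_congr rfl fun t _ => ?_
  rw [key]

end Toeplitz
-- Quadratic forms of complex matrices, inverses and Schur complements.
section QuadForm
variable {n m : Type*} [Fintype n] [Fintype m]

/-- The real part of the quadratic form of a matrix. -/
noncomputable def qf (L : Matrix n n ℂ) (v : n → ℂ) : ℝ := (star v ⬝ᵥ L *ᵥ v).re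

theorem qf_add (L M : Matrix n n ℂ) (v : n → ℂ) : qf (L + M) v = qf L v + qf M v := by
  simp [qf, add_mulVec]

theorem qf_sub (L M : Matrix n n ℂ) (v : n → ℂ) : qf (L - M) v = qf L v - qf M v := by
  simp [qf, sub_mulVec]

theorem qf_smul (c : ℝ) (L : Matrix n n ℂ) (v : n → ℂ) : qf ((c : ℂ) • L) v = c * qf L v := by
  simp [qf, smul_mulVec]

theorem qf_smul_vec (c : ℂ) (L : Matrix n n ℂ) (v : n → ℂ) :
    qf L (c • v) = ‖c‖ ^ 2 * qf L v := by
  have : star (c • v) ⬝ᵥ L *ᵥ (c • v) = ((‖c‖ ^ 2 : ℝ) : ℂ) * (star v ⬝ᵥ L *ᵥ v) := by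
    rw [star_smul, mulVec_smul, smul_dotProduct, dotProduct_smul, smul_eq_mul, smul_eq_mul,
      ← mul_assoc]
    congr 1
    rw [Complex.star_def, ← Complex.normSq_eq_conj_mul_self, Complex.normSq_eq_norm_sq]
  rw [qf, this, Complex.re_ofReal_mul, qf]

theorem qf_conjTranspose_mul_mul (L : Matrix n n ℂ) (B : Matrix n m ℂ) (v : m → ℂ) :
    qf (Bᴴ * L * B) v = qf L (B *ᵥ v) := by
  rw [qf, qf, ← mulVec_mulVec, ← mulVec_mulVec, dotProduct_mulVec, ← star_mulVec]

theorem qf_one [DecidableEq n] (v : n → ℂ) : qf (1 : Matrix n n ℂ) v = ∑ i, ‖v i‖ ^ 2 := by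
  simp only [qf, one_mulVec, dotProduct, Complex.re_sum, Pi.star_apply]
  refine Finset.sum_congr rfl fun i _ => ?_
  rw [Complex.star_def, ← Complex.normSq_eq_conj_mul_self, Complex.ofReal_re,
    Complex.normSq_eq_norm_sq]

theorem qf_vecMulVec (u v : n → ℂ) : qf (vecMulVec u (star u)) v = ‖star u ⬝ᵥ v‖ ^ 2 := by
  rw [qf, vecMulVec_mulVec, dotProduct_smul]
  have : star v ⬝ᵥ u = star (star u ⬝ᵥ v) := by rw [star_dotProduct]
  rw [this, MulOpposite.smul_eq_mul_unop, MulOpposite.unop_op, Complex.star_def,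
    ← Complex.normSq_eq_conj_mul_self, Complex.ofReal_re, Complex.normSq_eq_norm_sq]

theorem _root_.Matrix.PosSemidef.qf_nonneg {L : Matrix n n ℂ} (hL : L.PosSemidef) (v : n → ℂ) :
    0 ≤ qf L v :=
  (Complex.le_def.1 (hL.dotProduct_mulVec_nonneg v)).1

theorem qf_eq_of_isHermitian {L : Matrix n n ℂ} (hL : L.IsHermitian) (v : n → ℂ) :
    star v ⬝ᵥ L *ᵥ v = (qf L v : ℂ) := by
  refine Complex.ext rfl ?_
  have h : star v ⬝ᵥ L *ᵥ v = star (star (L *ᵥ v) ⬝ᵥ v) := star_dotProduct _ _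
  rw [star_mulVec, hL.eq, ← dotProduct_mulVec] at h
  have h' := congrArg Complex.im h
  simp at h'
  simp
  linarith

theorem posSemidef_iff_qf {L : Matrix n n ℂ} :
    L.PosSemidef ↔ L.IsHermitian ∧ ∀ v, 0 ≤ qf L v := by
  refine ⟨fun h => ⟨h.1, h.qf_nonneg⟩, fun ⟨h, h'⟩ => .of_dotProduct_mulVec_nonneg h fun v => ?_⟩
  rw [qf_eq_of_isHermitian h]
  exact_mod_cast h' v

theorem continuous_qf (v : n → ℂ) : Continuous fun L : Matrix n n ℂ => qf L v := by
  unfold qf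
  fun_prop

theorem continuous_qf_vec (L : Matrix n n ℂ) : Continuous fun v : n → ℂ => qf L v := by
  unfold qf
  fun_prop

theorem isClosed_posSemidef : IsClosed {L : Matrix n n ℂ | L.PosSemidef} := by
  simp only [posSemidef_iff_qf, Set.ofPred_and, Set.ofPred_forall]
  refine (isClosed_eq (continuous_id.matrix_conjTranspose) continuous_id).inter ?_
  exact isClosed_iInter fun v => isClosed_le continuous_const (continuous_qf v)

/-- Removes the regularisation that is added to forms and kernels in order to invert them. -/
theorem posSemidef_of_add_smul {M N : Matrix n n ℂ}
    (h : ∀ ε : ℝ, 0 < ε → (M + (ε : ℂ) • N).PosSemidef) : M.PosSemidef := by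
  have hc : Continuous fun ε : ℝ => M + (ε : ℂ) • N := by fun_prop
  have ht : Filter.Tendsto (fun ε : ℝ => M + (ε : ℂ) • N) (𝓝[>] 0) (𝓝 M) := by
    have := (hc.tendsto 0).mono_left (nhdsWithin_le_nhds (s := Set.Ioi 0))
    simpa using this
  exact isClosed_posSemidef.mem_of_tendsto ht
    (Filter.eventually_of_mem self_mem_nhdsWithin fun ε hε => h ε hε)

/-- The two Schur complements of a block matrix are positive simultaneously. -/
theorem posSemidef_schur_iff [DecidableEq n] [DecidableEq m] {A : Matrix n n ℂ} {D : Matrix m m ℂ}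
    (hA : A.PosDef) (hD : D.PosDef) (B : Matrix m n ℂ) :
    (D - B * A⁻¹ * Bᴴ).PosSemidef ↔ (A - Bᴴ * D⁻¹ * B).PosSemidef := by
  have := hA.isUnit.invertible
  have := hD.isUnit.invertible
  have h1 := PosDef.fromBlocks₁₁ Bᴴ D hA
  have h2 := PosDef.fromBlocks₂₂ A Bᴴ hD
  rw [conjTranspose_conjTranspose] at h1 h2
  rw [← h1, h2]

/-- The two sides are the Schur complements of the block matrix with diagonal blocks `k⁻¹`, `k` and
off-diagonal blocks `T`, `Tᴴ`. This is the passage between kernels and forms. -/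
theorem posSemidef_sub_conj_iff [DecidableEq n] {k : Matrix n n ℂ} (hk : k.PosDef)
    (T : Matrix n n ℂ) :
    (k - T * k * Tᴴ).PosSemidef ↔ (k⁻¹ - Tᴴ * k⁻¹ * T).PosSemidef := by
  have := posSemidef_schur_iff hk.inv hk T
  rwa [nonsing_inv_nonsing_inv _ ((isUnit_iff_isUnit_det _).1 hk.isUnit)] at this

omit [Fintype n] in
theorem posDef_smul_one [DecidableEq n] {c : ℝ} (hc : 0 < c) :
    ((c : ℂ) • (1 : Matrix n n ℂ)).PosDef :=
  PosDef.one.smul (by exact_mod_cast hc)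

/-- At `v = L⁻¹u` the hypothesis reads `q² ≤ cq` with `q = qf L⁻¹ u`. -/
theorem qf_inv_le [DecidableEq n] {L : Matrix n n ℂ} (hL : L.PosDef) {u : n → ℂ} {c : ℝ}
    (hc : 0 < c) (h : ∀ v, ‖star u ⬝ᵥ v‖ ^ 2 ≤ c * qf L v) : qf L⁻¹ u ≤ c := by
  set w := L⁻¹ *ᵥ u with hw
  have hdet := (isUnit_iff_isUnit_det _).1 hL.isUnit
  have h1 : L *ᵥ w = u := by rw [hw, mulVec_mulVec, mul_nonsing_inv _ hdet, one_mulVec]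
  have h2 : star u ⬝ᵥ w = (qf L⁻¹ u : ℂ) := qf_eq_of_isHermitian hL.inv.1 u
  have h3 : qf L w = qf L⁻¹ u := by
    have : qf L (L⁻¹ *ᵥ u) = qf L⁻¹ u := by
      rw [← qf_conjTranspose_mul_mul, hL.inv.1.eq, mul_assoc, mul_nonsing_inv _ hdet, mul_one]
    exact this
  have h4 := h w
  have h5 := hL.inv.posSemidef.qf_nonneg u
  rw [h2, h3, Complex.norm_real, Real.norm_eq_abs, sq_abs] at h4
  by_contra! h6
  nlinarith

/-- Cauchy–Schwarz in the inner product of `L` for `v` and `w = L⁻¹u`, read off from positivity at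
`qv - zw`. -/
theorem dotProduct_sq_le [DecidableEq n] {L : Matrix n n ℂ} (hL : L.PosDef) (u v : n → ℂ) :
    ‖star u ⬝ᵥ v‖ ^ 2 ≤ qf L v * qf L⁻¹ u := by
  set w := L⁻¹ *ᵥ u with hw
  have hdet := (isUnit_iff_isUnit_det _).1 hL.isUnit
  have h1 : L *ᵥ w = u := by rw [hw, mulVec_mulVec, mul_nonsing_inv _ hdet, one_mulVec]
  have h2 : star u ⬝ᵥ w = (qf L⁻¹ u : ℂ) := qf_eq_of_isHermitian hL.inv.1 u
  have h3 : star w ⬝ᵥ L *ᵥ v = star u ⬝ᵥ v := by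
    rw [hw, star_mulVec, hL.inv.1.eq, ← dotProduct_mulVec, mulVec_mulVec,
      nonsing_inv_mul _ hdet, one_mulVec]
  have h3' : star w ⬝ᵥ u = (qf L⁻¹ u : ℂ) := by
    rw [hw, star_mulVec, hL.inv.1.eq, ← dotProduct_mulVec]
    exact h2
  have h4 : star v ⬝ᵥ u = star (star u ⬝ᵥ v) := by rw [star_dotProduct]
  set q := qf L⁻¹ u with hq
  set z := star u ⬝ᵥ v with hz
  have h5 : qf L ((q : ℂ) • v - z • w) = q * (q * qf L v - ‖z‖ ^ 2) := by
    have hzz : star z * z = ((‖z‖ ^ 2 : ℝ) : ℂ) := by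
      rw [Complex.star_def, ← Complex.normSq_eq_conj_mul_self, Complex.normSq_eq_norm_sq]
    have : star ((q : ℂ) • v - z • w) ⬝ᵥ L *ᵥ ((q : ℂ) • v - z • w)
        = ((q * (q * qf L v - ‖z‖ ^ 2) : ℝ) : ℂ) := by
      simp only [star_sub, star_smul, mulVec_sub, mulVec_smul, sub_dotProduct, dotProduct_sub,
        smul_dotProduct, dotProduct_smul, smul_eq_mul, h1, h3, h3', h4,
        qf_eq_of_isHermitian hL.1 v, Complex.star_def, Complex.conj_ofReal]
      rw [Complex.star_def] at hzz
      push_cast at hzz ⊢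
      linear_combination (-(q : ℂ)) * hzz
    rw [qf, this, Complex.ofReal_re]
  have h6 := hL.posSemidef.qf_nonneg ((q : ℂ) • v - z • w)
  rw [h5] at h6
  have hq0 : 0 ≤ q := hL.inv.posSemidef.qf_nonneg u
  rcases hq0.eq_or_lt with h | h
  · have hu : u = 0 := by
      by_contra hu
      have := (Complex.lt_def.1 (hL.inv.dotProduct_mulVec_pos hu)).1
      exact this.ne h
    simp [hz, hu, ← h]
  · have := nonneg_of_mul_nonneg_right h6 h
    linarith

theorem qf_add_vec_le {L : Matrix n n ℂ} (hL : L.PosSemidef) (u v : n → ℂ) :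
    qf L (u + v) ≤ 2 * qf L u + 2 * qf L v := by
  have h : qf L (u + v) + qf L (u - v) = 2 * qf L u + 2 * qf L v := by
    simp only [qf, star_add, star_sub, mulVec_add, mulVec_sub, dotProduct_add, add_dotProduct,
      dotProduct_sub, sub_dotProduct, Complex.add_re, Complex.sub_re]
    ring
  linarith [hL.qf_nonneg (u - v)]

end QuadForm

/-! ### The cone of forms and the unit ball in an abstract algebra. -/

/-- A unital associative algebra structure on `n → ℂ`, given by its left regular representation. -/
structure LeftRegular (n : Type*) [Fintype n] [DecidableEq n] where
  toLin : (n → ℂ) →ₗ[ℂ] Matrix n n ℂ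
  unit : n → ℂ
  map_mulVec : ∀ f g, toLin (toLin f *ᵥ g) = toLin f * toLin g
  map_unit : toLin unit = 1
  mulVec_unit : ∀ f, toLin f *ᵥ unit = f

namespace LeftRegular
variable {n : Type*} [Fintype n] [DecidableEq n] (A : LeftRegular n) (S : Set (n → ℂ))

/-- The positive matrices whose quadratic form is decreased by the left multiplications by the
elements of `S`. -/
def cone : Set (Matrix n n ℂ) :=
  {L | L.PosSemidef ∧ ∀ ψ ∈ S, (L - (A.toLin ψ)ᴴ * L * A.toLin ψ).PosSemidef}

/-- The unit ball of the norm determined by the test set `S`. -/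
def ball : Set (n → ℂ) := {f | ∀ L ∈ A.cone S, qf L f ≤ qf L A.unit}

/-- Right multiplication as a matrix. -/
noncomputable def right (h : n → ℂ) : Matrix n n ℂ :=
  LinearMap.toMatrix' ((Matrix.mulVecBilin ℂ ℂ).flip h ∘ₗ A.toLin)

@[simp] theorem right_mulVec (h g : n → ℂ) : A.right h *ᵥ g = A.toLin g *ᵥ h := by
  rw [right, LinearMap.toMatrix'_mulVec]
  rfl

theorem right_mulVec_unit (h : n → ℂ) : A.right h *ᵥ A.unit = h := by
  rw [right_mulVec, map_unit, one_mulVec]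

theorem toLin_mul_right (f h : n → ℂ) : A.toLin f * A.right h = A.right h * A.toLin f := by
  refine Matrix.mulVec_injective (funext fun g => ?_)
  rw [← mulVec_mulVec, ← mulVec_mulVec, right_mulVec, right_mulVec, map_mulVec, mulVec_mulVec]

variable {A S}

/-- Right multiplications commute with left ones, so the congruence preserves each defining
inequality. An inequality at the unit, valid on the whole cone, thereby spreads to all vectors. -/
theorem right_mem_cone {L : Matrix n n ℂ} (hL : L ∈ A.cone S) (h : n → ℂ) :
    (A.right h)ᴴ * L * A.right h ∈ A.cone S := by
  refine ⟨hL.1.conjTranspose_mul_mul_same _, fun ψ hψ => ?_⟩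
  convert (hL.2 ψ hψ).conjTranspose_mul_mul_same (A.right h) using 1
  rw [mul_sub, sub_mul]
  congr 1
  calc (A.toLin ψ)ᴴ * ((A.right h)ᴴ * L * A.right h) * A.toLin ψ
      = (A.right h * A.toLin ψ)ᴴ * L * (A.right h * A.toLin ψ) := by
        simp only [conjTranspose_mul, mul_assoc]
    _ = _ := by
        rw [← toLin_mul_right]
        simp only [conjTranspose_mul, mul_assoc]

theorem smul_mem_cone {L : Matrix n n ℂ} (hL : L ∈ A.cone S) {c : ℝ} (hc : 0 ≤ c) :
    (c : ℂ) • L ∈ A.cone S := by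
  have hc' : (0 : ℂ) ≤ c := by exact_mod_cast hc
  refine ⟨hL.1.smul hc', fun ψ hψ => ?_⟩
  convert (hL.2 ψ hψ).smul hc' using 1
  rw [smul_sub, Matrix.mul_smul, Matrix.smul_mul]

theorem add_mem_cone {L M : Matrix n n ℂ} (hL : L ∈ A.cone S) (hM : M ∈ A.cone S) :
    L + M ∈ A.cone S := by
  refine ⟨hL.1.add hM.1, fun ψ hψ => ?_⟩
  convert (hL.2 ψ hψ).add (hM.2 ψ hψ) using 1
  rw [mul_add, add_mul]
  abel

theorem zero_mem_cone : (0 : Matrix n n ℂ) ∈ A.cone S :=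
  ⟨.zero, fun ψ _ => by simpa using PosSemidef.zero⟩

variable (A S) in
theorem isClosed_cone : IsClosed (A.cone S) := by
  simp only [cone, Set.ofPred_and, Set.ofPred_forall]
  refine isClosed_posSemidef.inter (isClosed_iInter fun ψ => isClosed_iInter fun _ => ?_)
  exact isClosed_posSemidef.preimage (by fun_prop)

/-- Membership in the unit ball gives contractivity for all forms in the cone. -/
theorem posSemidef_of_mem_ball {f : n → ℂ} (hf : f ∈ A.ball S) {L : Matrix n n ℂ}
    (hL : L ∈ A.cone S) : (L - (A.toLin f)ᴴ * L * A.toLin f).PosSemidef := by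
  refine posSemidef_iff_qf.2 ⟨?_, fun v => ?_⟩
  · exact hL.1.1.sub (isHermitian_conjTranspose_mul_mul _ hL.1.1)
  · have := hf _ (right_mem_cone hL v)
    rw [qf_conjTranspose_mul_mul, qf_conjTranspose_mul_mul, right_mulVec, right_mulVec,
      map_unit, one_mulVec] at this
    rw [qf_sub, qf_conjTranspose_mul_mul]
    linarith

/-- If `S` generates the algebra, then every element is bounded. -/
theorem exists_bound (hgen : ∀ M : Submodule ℂ (n → ℂ), A.unit ∈ M → S ⊆ M →
    (∀ f ∈ M, ∀ g ∈ M, A.toLin f *ᵥ g ∈ M) → M = ⊤) (f : n → ℂ) :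
    ∃ C : ℝ, 0 ≤ C ∧ ∀ L ∈ A.cone S, qf L f ≤ C * qf L A.unit := by
  -- The elements bounded in this sense contain the unit and `S`, and they form a subalgebra: for
  -- products, `L(fg)` is the value at `f` of the form transported by right multiplication by `g`.
  let M : Submodule ℂ (n → ℂ) :=
    { carrier := {f | ∃ C : ℝ, 0 ≤ C ∧ ∀ L ∈ A.cone S, qf L f ≤ C * qf L A.unit}
      add_mem' := by
        rintro f g ⟨C, hC0, hC⟩ ⟨D, hD0, hD⟩
        refine ⟨2 * C + 2 * D, by positivity, fun L hL => ?_⟩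
        have := qf_add_vec_le hL.1 f g
        linarith [hC L hL, hD L hL]
      zero_mem' := ⟨0, le_rfl, fun L hL => by simp [qf]⟩
      smul_mem' := by
        rintro c f ⟨C, hC0, hC⟩
        refine ⟨‖c‖ ^ 2 * C, by positivity, fun L hL => ?_⟩
        rw [qf_smul_vec, mul_assoc]
        exact mul_le_mul_of_nonneg_left (hC L hL) (by positivity) }
  have hM : M = ⊤ := by
    refine hgen M ⟨1, zero_le_one, fun L hL => by simp⟩ ?_ ?_
    · intro ψ hψ
      refine ⟨1, zero_le_one, fun L hL => ?_⟩
      have := (hL.2 ψ hψ).qf_nonneg A.unit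
      rw [qf_sub, qf_conjTranspose_mul_mul, mulVec_unit] at this
      linarith
    · rintro f ⟨C, hC0, hC⟩ g ⟨D, hD0, hD⟩
      refine ⟨C * D, by positivity, fun L hL => ?_⟩
      have := hC _ (right_mem_cone hL g)
      rw [qf_conjTranspose_mul_mul, qf_conjTranspose_mul_mul, right_mulVec,
        right_mulVec_unit] at this
      refine this.trans ?_
      rw [mul_assoc]
      exact mul_le_mul_of_nonneg_left (hD L hL) hC0
  have : f ∈ M := hM ▸ Submodule.mem_top
  exact this

end LeftRegular
-- Positive matrices, trace pairing and Hermitian separation.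
section Separation
variable {n : Type*} [Fintype n]

open scoped MatrixOrder Matrix.Norms.L2Operator in
theorem _root_.Matrix.PosSemidef.exists_conjTranspose_mul_self {L : Matrix n n ℂ}
    (hL : L.PosSemidef) : ∃ Y : Matrix n n ℂ, L = Yᴴ * Y := by
  obtain ⟨Y, hY⟩ := CStarAlgebra.nonneg_iff_eq_star_mul_self.1 hL.nonneg
  exact ⟨Y, hY⟩

theorem qf_conjTranspose_mul_self (Y : Matrix n n ℂ) (v : n → ℂ) :
    qf (Yᴴ * Y) v = ∑ k, ‖(Y *ᵥ v) k‖ ^ 2 := by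
  have := qf_conjTranspose_mul_mul 1 Y v
  rwa [mul_one, qf_one] at this

theorem trace_mul_vecMulVec (H : Matrix n n ℂ) (g h : n → ℂ) :
    (H * vecMulVec g (star h)).trace = star h ⬝ᵥ H *ᵥ g := by
  rw [mul_vecMulVec, trace_vecMulVec, dotProduct_comm]

theorem trace_conjTranspose_mul_self_mul (B X : Matrix n n ℂ) :
    (Bᴴ * B * X).trace.re = ∑ i, qf X (star (B i)) := by
  rw [mul_assoc, trace_mul_comm, trace, Complex.re_sum]
  refine Finset.sum_congr rfl fun i _ => ?_
  rw [qf, star_star, diag_apply, mul_assoc, mul_apply_eq_vecMul, vecMul, dotProduct]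
  rfl

/-- The Cauchy–Schwarz inequality for the form of a positive matrix, for families. -/
theorem qf_sum_smul_le {ι : Type*} [Fintype ι] {L : Matrix n n ℂ} (hL : L.PosSemidef)
    (c : ι → ℂ) (b : ι → n → ℂ) :
    qf L (∑ i, c i • b i) ≤ (∑ i, ‖c i‖ ^ 2) * ∑ i, qf L (b i) := by
  obtain ⟨Y, rfl⟩ := hL.exists_conjTranspose_mul_self
  simp only [qf_conjTranspose_mul_self]
  rw [Finset.sum_comm, Finset.mul_sum]
  refine Finset.sum_le_sum fun k _ => ?_
  have h1 : ‖(Y *ᵥ ∑ i, c i • b i) k‖ ≤ ∑ i, ‖c i‖ * ‖(Y *ᵥ b i) k‖ := by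
    rw [mulVec_sum, Finset.sum_apply]
    refine (norm_sum_le _ _).trans (Finset.sum_le_sum fun i _ => ?_)
    rw [mulVec_smul, Pi.smul_apply, norm_smul]
  calc _ ≤ (∑ i, ‖c i‖ * ‖(Y *ᵥ b i) k‖) ^ 2 := by gcongr
    _ ≤ _ := Finset.sum_mul_sq_le_sq_mul_sq _ _ _

/-- Separation of a Hermitian matrix from a closed convex set of Hermitian matrices by a Hermitian
matrix. -/
theorem exists_isHermitian_separating {C : Set (Matrix n n ℂ)} (hconv : Convex ℝ C)
    (hclosed : IsClosed C) (hherm : ∀ X ∈ C, X.IsHermitian) {M : Matrix n n ℂ}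
    (hMh : M.IsHermitian) (hM : M ∉ C) :
    ∃ (H : Matrix n n ℂ) (u : ℝ), H.IsHermitian ∧ (∀ X ∈ C, (H * X).trace.re < u) ∧
      u < (H * M).trace.re := by
  have : LocallyConvexSpace ℝ (Matrix n n ℂ) := inferInstanceAs (LocallyConvexSpace ℝ (n → n → ℂ))
  obtain ⟨f, u, h1, h2⟩ := RCLike.geometric_hahn_banach_closed_point (𝕜 := ℂ) hconv hclosed hM
  let K : Matrix n n ℂ := Matrix.of fun i j => f (single j i 1)
  have hf : ∀ X, f X = (K * X).trace := fun X => by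
    conv_lhs => rw [matrix_eq_sum_single X]
    simp only [map_sum, trace, diag_apply, mul_apply]
    rw [Finset.sum_comm]
    refine Finset.sum_congr rfl fun i _ => Finset.sum_congr rfl fun j _ => ?_
    have : single j i (X j i) = X j i • single j i (1 : ℂ) := by simp
    rw [this, map_smul, smul_eq_mul, mul_comm]
    rfl
  have hre : ∀ X : Matrix n n ℂ, X.IsHermitian →
      ((((1 / 2 : ℝ) : ℂ) • (K + Kᴴ)) * X).trace.re = RCLike.re (f X) := fun X hX => by
    have h3 : (Kᴴ * X).trace.re = (K * X).trace.re := by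
      have : (Kᴴ * X).trace = star (K * X).trace := by
        rw [← trace_conjTranspose, conjTranspose_mul, hX.eq, trace_mul_comm]
      rw [this]
      simp
    rw [hf, Matrix.smul_mul, trace_smul, smul_eq_mul, Complex.re_ofReal_mul, add_mul, trace_add,
      Complex.add_re, h3]
    simp only [RCLike.re_to_complex]
    ring
  refine ⟨((1 / 2 : ℝ) : ℂ) • (K + Kᴴ), u, ?_, fun X hX => ?_, ?_⟩
  · rw [IsHermitian, conjTranspose_smul, conjTranspose_add, conjTranspose_conjTranspose,
      add_comm Kᴴ]
    simp
  · rw [hre X (hherm X hX)]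
    exact h1 X hX
  · rw [hre M hMh]
    exact h2

theorem norm_apply_le_of_posSemidef [DecidableEq n] {L : Matrix n n ℂ}
    (hL : L.PosSemidef) (i j : n) :
    ‖L i j‖ ≤ qf L (Pi.single i 1) + qf L (Pi.single j 1) := by
  obtain ⟨Y, rfl⟩ := hL.exists_conjTranspose_mul_self
  simp only [qf_conjTranspose_mul_self]
  rw [mul_apply, ← Finset.sum_add_distrib]
  refine (norm_sum_le _ _).trans (Finset.sum_le_sum fun k _ => ?_)
  rw [norm_mul, conjTranspose_apply, norm_star]
  simp only [mulVec_single_one, col_apply]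
  nlinarith [sq_nonneg (‖Y k i‖ - ‖Y k j‖), sq_nonneg ‖Y k i‖, sq_nonneg ‖Y k j‖]

end Separation

/-! ### Dominating a functional by a form, and compactness of the ball. -/

namespace LeftRegular
variable {n : Type*} [Fintype n] [DecidableEq n] {A : LeftRegular n} {S : Set (n → ℂ)}

/-- The value at the unit controls the diagonal entries and hence all entries; the bounds `hbd` come
from generation by the test set. -/
theorem isCompact_cone_slice
    (hbd : ∀ f, ∃ C : ℝ, 0 ≤ C ∧ ∀ L ∈ A.cone S, qf L f ≤ C * qf L A.unit) :
    IsCompact {L | L ∈ A.cone S ∧ qf L A.unit ≤ 1} := by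
  choose C hC0 hC using hbd
  have hK : IsCompact (Set.univ.pi fun i : n => Set.univ.pi fun j : n =>
      Metric.closedBall (0 : ℂ) (C (Pi.single i 1) + C (Pi.single j 1))) :=
    isCompact_univ_pi fun i => isCompact_univ_pi fun j => isCompact_closedBall _ _
  refine hK.of_isClosed_subset
    ((A.isClosed_cone S).inter (isClosed_le (continuous_qf A.unit) continuous_const)) ?_
  rintro L ⟨hL, hL1⟩ i - j -
  rw [mem_closedBall_zero_iff]
  refine (norm_apply_le_of_posSemidef hL.1 i j).trans (add_le_add ?_ ?_)
  · exact (hC (Pi.single i 1) L hL).trans (mul_le_of_le_one_right (hC0 (Pi.single i 1)) hL1)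
  · exact (hC (Pi.single j 1) L hL).trans (mul_le_of_le_one_right (hC0 (Pi.single j 1)) hL1)

open scoped Pointwise in
/-- A functional which is contractive on the unit ball is dominated by a form in the cone. -/
theorem exists_dominating
    (hbd : ∀ f, ∃ C : ℝ, 0 ≤ C ∧ ∀ L ∈ A.cone S, qf L f ≤ C * qf L A.unit)
    (u : n → ℂ) (hu : ∀ g ∈ A.ball S, ‖star u ⬝ᵥ g‖ ≤ 1) :
    ∃ L ∈ A.cone S, qf L A.unit ≤ 1 ∧ ∀ v, ‖star u ⬝ᵥ v‖ ^ 2 ≤ qf L v := by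
  set K : Set (Matrix n n ℂ) := {L | L ∈ A.cone S ∧ qf L A.unit ≤ 1} with hK
  have hKc : IsCompact K := isCompact_cone_slice hbd
  have hK0 : (0 : Matrix n n ℂ) ∈ K := ⟨zero_mem_cone, by simp [qf]⟩
  set N : Set (Matrix n n ℂ) := {X | (-X).PosSemidef} with hN
  have hN0 : (0 : Matrix n n ℂ) ∈ N := by simpa [hN] using PosSemidef.zero
  have hKconv : Convex ℝ K := by
    rintro L ⟨hL, hL1⟩ M ⟨hM, hM1⟩ a b ha hb hab
    have h1 : ∀ (r : ℝ) (X : Matrix n n ℂ), r • X = (r : ℂ) • X := fun r X => by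
      ext; simp
    refine ⟨?_, ?_⟩
    · rw [h1, h1]
      exact add_mem_cone (smul_mem_cone hL ha) (smul_mem_cone hM hb)
    · rw [h1, h1, qf_add, qf_smul, qf_smul]
      nlinarith
  have hNconv : Convex ℝ N := by
    intro L hL M hM a b ha hb hab
    have : -(a • L + b • M) = a • (-L) + b • (-M) := by simp; abel
    rw [hN, Set.mem_ofPred_eq, this]
    exact (PosSemidef.smul hL ha).add (PosSemidef.smul hM hb)
  have hNcl : IsClosed N := isClosed_posSemidef.preimage continuous_neg
  -- Membership says that a form of the slice dominates the rank-one form of `u`. Otherwise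
  -- separation applies, `K + N` being closed because `K` is compact and `N` closed.
  by_cases hmem : vecMulVec u (star u) ∈ K + N
  · obtain ⟨L, hL, X, hX, hLX⟩ := Set.mem_add.1 hmem
    refine ⟨L, hL.1, hL.2, fun v => ?_⟩
    have h1 := hX.qf_nonneg v
    rw [← qf_vecMulVec, ← hLX, qf_add]
    rw [← zero_sub, qf_sub] at h1
    simp only [qf, zero_mulVec, dotProduct_zero, Complex.zero_re] at h1 ⊢
    linarith
  exfalso
  obtain ⟨H, c, hH, h1, h2⟩ := exists_isHermitian_separating (hKconv.add hNconv)
    (hNcl.add_left_of_isCompact hKc) (by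
      rintro _ ⟨L, hL, X, hX, rfl⟩
      exact hL.1.1.1.add (by simpa using hX.1.neg)) (posSemidef_vecMulVec_self_star u).1 hmem
  have hc : 0 < c := by
    have := h1 (0 + 0) (Set.add_mem_add hK0 hN0)
    simpa using this
  -- A negative direction `v` of `H` would violate the upper bound `c` on the negative multiple of
  -- `vv*` scaled to reach exactly `c`.
  have hHpos : H.PosSemidef := by
    refine posSemidef_iff_qf.2 ⟨hH, fun v => ?_⟩
    by_contra! hv
    have hX : ((-(c / -qf H v) : ℝ) : ℂ) • vecMulVec v (star v) ∈ N := by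
      rw [hN, Set.mem_ofPred_eq, Complex.ofReal_neg, neg_smul, neg_neg]
      refine (posSemidef_vecMulVec_self_star v).smul ?_
      have : 0 ≤ c / -qf H v := div_nonneg hc.le (by linarith)
      exact_mod_cast this
    have := h1 _ (Set.add_mem_add hK0 hX)
    rw [zero_add, Matrix.mul_smul, trace_smul, trace_mul_vecMulVec, smul_eq_mul,
      Complex.re_ofReal_mul] at this
    change -(c / -qf H v) * qf H v < c at this
    rw [neg_mul, div_mul_eq_mul_div, neg_lt, lt_div_iff₀ (by linarith)] at this
    linarith
  obtain ⟨B, rfl⟩ := hHpos.exists_conjTranspose_mul_self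
  set b : n → n → ℂ := fun i => star (B i) with hb
  rw [trace_conjTranspose_mul_self_mul] at h2
  simp only [qf_vecMulVec] at h2
  set s : ℝ := ∑ i, ‖star u ⬝ᵥ b i‖ ^ 2 with hs
  have hcs : c < s := h2
  have hKle : ∀ L ∈ K, ∑ i, qf L (b i) ≤ c := fun L hL => by
    have := h1 _ (Set.add_mem_add hL hN0)
    rw [add_zero, trace_conjTranspose_mul_self_mul] at this
    exact this.le
  -- For this combination `⟨u, g⟩ = s`, while Cauchy–Schwarz gives `L(g) ≤ sc` on the slice. So `g /
  -- √(sc)` lies in the ball, and `s > c` contradicts the bound on `u`.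
  set g : n → ℂ := ∑ i, star (star u ⬝ᵥ b i) • b i with hg
  have hug : star u ⬝ᵥ g = (s : ℂ) := by
    rw [hg, dotProduct_sum, hs]
    push_cast
    refine Finset.sum_congr rfl fun i _ => ?_
    rw [dotProduct_smul, smul_eq_mul, Complex.star_def, ← Complex.normSq_eq_conj_mul_self,
      Complex.normSq_eq_norm_sq]
    push_cast
    rfl
  have hqg : ∀ L ∈ K, qf L g ≤ s * c := fun L hL => by
    refine (qf_sum_smul_le hL.1.1 _ _).trans ?_
    simp only [norm_star]
    exact mul_le_mul_of_nonneg_left (hKle L hL) (by positivity)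
  have hs0 : 0 < s := hc.trans hcs
  have hsc : 0 < s * c := mul_pos hs0 hc
  have hball : ((1 / √(s * c) : ℝ) : ℂ) • g ∈ A.ball S := by
    intro L hL
    have hn : ‖((1 / √(s * c) : ℝ) : ℂ)‖ ^ 2 = 1 / (s * c) := by
      rw [Complex.norm_real, Real.norm_eq_abs, sq_abs, div_pow, Real.sq_sqrt hsc.le, one_pow]
    rw [qf_smul_vec, hn, one_div, inv_mul_le_iff₀ hsc]
    have hδ := hL.1.qf_nonneg A.unit
    -- A form vanishing at the unit cannot be normalised into the slice; it vanishes at `g` by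
    -- `hbd`.
    rcases hδ.eq_or_lt with h | h
    · obtain ⟨C, -, hC⟩ := hbd g
      have := hC L hL
      rw [← h] at this ⊢
      simpa using this
    · have := hqg (((qf L A.unit)⁻¹ : ℝ) • L) ⟨?_, ?_⟩
      · rw [show ((qf L A.unit)⁻¹ : ℝ) • L = (((qf L A.unit)⁻¹ : ℝ) : ℂ) • L by ext; simp,
          qf_smul, inv_mul_le_iff₀ h] at this
        linarith
      · rw [show ((qf L A.unit)⁻¹ : ℝ) • L = (((qf L A.unit)⁻¹ : ℝ) : ℂ) • L by ext; simp]
        exact smul_mem_cone hL (inv_nonneg.2 hδ)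
      · rw [show ((qf L A.unit)⁻¹ : ℝ) • L = (((qf L A.unit)⁻¹ : ℝ) : ℂ) • L by ext; simp,
          qf_smul, inv_mul_cancel₀ h.ne']
  have := hu _ hball
  rw [dotProduct_smul, hug, smul_eq_mul, ← Complex.ofReal_mul, Complex.norm_real,
    Real.norm_eq_abs, abs_of_nonneg (by positivity), one_div, inv_mul_le_iff₀ (by positivity),
    mul_one] at this
  have h3 : s ^ 2 ≤ s * c := by
    rw [← Real.sq_sqrt hsc.le]
    gcongr
  nlinarith

theorem isClosed_ball : IsClosed (A.ball S) := by
  simp only [ball, Set.ofPred_forall]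
  exact isClosed_iInter fun L => isClosed_iInter fun _ =>
    isClosed_le (continuous_qf_vec L) continuous_const

theorem convex_ball : Convex ℝ (A.ball S) := by
  intro f hf g hg a b ha hb hab L hL
  -- Splitting each weight into two square roots yields `L(af + bg) ≤ (a + b)(a L(f) + b L(g))`.
  have h := qf_sum_smul_le hL.1 (fun i : Fin 2 => ((√(![a, b] i) : ℝ) : ℂ))
    (fun i => ((√(![a, b] i) : ℝ) : ℂ) • ![f, g] i)
  simp only [Fin.sum_univ_two, smul_smul, ← Complex.ofReal_mul, qf_smul_vec, Complex.norm_real,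
    Real.norm_eq_abs, sq_abs, Matrix.cons_val_zero, Matrix.cons_val_one,
    Real.mul_self_sqrt ha, Real.mul_self_sqrt hb, Real.sq_sqrt ha, Real.sq_sqrt hb, hab,
    one_mul] at h
  have h1 : a • f + b • g = (a : ℂ) • f + (b : ℂ) • g := by ext; simp
  rw [h1]
  refine h.trans ?_
  have h2 := mul_le_mul_of_nonneg_left (hf L hL) ha
  have h3 := mul_le_mul_of_nonneg_left (hg L hL) hb
  have h4 : qf L A.unit = a * qf L A.unit + b * qf L A.unit := by rw [← add_mul, hab, one_mul]
  linarith

theorem smul_mem_ball {f : n → ℂ} (hf : f ∈ A.ball S) {c : ℂ} (hc : ‖c‖ ≤ 1) :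
    c • f ∈ A.ball S := by
  intro L hL
  rw [qf_smul_vec]
  refine le_trans ?_ (hf L hL)
  exact mul_le_of_le_one_left (hL.1.qf_nonneg f) (pow_le_one₀ (norm_nonneg _) hc)

theorem zero_mem_ball : (0 : n → ℂ) ∈ A.ball S := fun L hL => by
  simpa [qf] using hL.1.qf_nonneg A.unit

/-- If all test elements are contractions, then the unit ball is bounded. -/
theorem norm_apply_le_of_mem_ball
    (hcontr : ∀ ψ ∈ S, (1 - (A.toLin ψ)ᴴ * A.toLin ψ).PosSemidef) {f : n → ℂ}
    (hf : f ∈ A.ball S) (i : n) : ‖f i‖ ^ 2 ≤ ∑ j, ‖A.unit j‖ ^ 2 := by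
  have h1 : (1 : Matrix n n ℂ) ∈ A.cone S :=
    ⟨.one, fun ψ hψ => by simpa using hcontr ψ hψ⟩
  have := hf 1 h1
  rw [qf_one, qf_one] at this
  exact (Finset.single_le_sum (f := fun j => ‖f j‖ ^ 2) (fun j _ => by positivity)
    (Finset.mem_univ i)).trans this

theorem isCompact_ball
    (hcontr : ∀ ψ ∈ S, (1 - (A.toLin ψ)ᴴ * A.toLin ψ).PosSemidef) : IsCompact (A.ball S) := by
  refine (isCompact_univ_pi fun _ : n =>
    isCompact_closedBall (0 : ℂ) √(∑ j, ‖A.unit j‖ ^ 2)).of_isClosed_subset isClosed_ball ?_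
  intro f hf i _
  rw [mem_closedBall_zero_iff]
  exact Real.le_sqrt_of_sq_le (norm_apply_le_of_mem_ball hcontr hf i)

end LeftRegular
-- Positivity of kernels tested on finite lower sets.
section Kernels

theorem isPosKernel_iff_posSemidef {α : Type*} [Fintype α] {k : α → α → ℂ} :
    IsPosKernel k ↔ (Matrix.of k).PosSemidef := by
  refine ⟨fun h => ?_, fun h A => h.submatrix (fun x : A => (x : α))⟩
  exact (h Finset.univ).submatrix (fun x : α => (⟨x, Finset.mem_univ x⟩ : (Finset.univ : Finset α)))

variable {G : Type*} [Semigroupoid G]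

/-- Positivity passes to principal submatrices, and the finite lower sets containing `F₀` are
cofinal among finite sets. -/
theorem isPosKernel_of_forall_isLower (F₀ : Finset G) (hF₀ : IsLower (F₀ : Set G))
    {k : G → G → ℂ}
    (h : ∀ F : Finset G, F₀ ⊆ F → IsLower (F : Set G) →
      (Matrix.of fun a b : F => k a b).PosSemidef) : IsPosKernel k := by
  intro A
  obtain ⟨F, hAF, hF⟩ := exists_isLower_superset A
  have := h (F₀ ∪ F) Finset.subset_union_left (by rw [Finset.coe_union]; exact hF₀.union hF)
  exact this.submatrix fun a : A => (⟨a, Finset.mem_union_right _ (hAF a.2)⟩ : (F₀ ∪ F : Finset G))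

end Kernels

/-! ### The cone attached to a finite lower set. -/

section LowerSets
variable {G : Type*} [Semigroupoid G]

/-- The convolution algebra of functions on a finite lower set. -/
noncomputable def lowerAlg (F : Finset G) (hF : IsLower (F : Set G)) : LeftRegular F where
  toLin := toeplitzLin F
  unit := fun x => delta (x : G)
  map_mulVec := toeplitz_mulVec hF
  map_unit := toeplitz_delta hF
  mulVec_unit := toeplitz_mulVec_delta hF

/-- The restrictions to `F` of the members of `Ψ`. -/
def testSet (Ψ : Set (G → ℂ)) (F : Finset G) : Set (F → ℂ) :=
  (fun (ψ : G → ℂ) (x : F) => ψ x) '' Ψ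

variable {Ψ : Set (G → ℂ)} {F : Finset G} (hF : IsLower (F : Set G))

theorem mem_cone_iff {L : Matrix F F ℂ} : L ∈ (lowerAlg F hF).cone (testSet Ψ F) ↔
    L.PosSemidef ∧ ∀ ψ ∈ Ψ, (L - (toeplitz fun x : F => ψ x)ᴴ * L *
      toeplitz fun x : F => ψ x).PosSemidef :=
  and_congr_right fun _ => Set.forall_mem_image

theorem posSemidef_one_sub_of_toeplitzNorm_le {f : F → ℂ} (h : toeplitzNorm F f ≤ 1) :
    (1 - (toeplitz f)ᴴ * toeplitz f).PosSemidef := by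
  refine posSemidef_iff_qf.2 ⟨isHermitian_one.sub (isHermitian_conjTranspose_mul_self _),
    fun v => ?_⟩
  have h1 := qf_conjTranspose_mul_mul 1 (toeplitz f) v
  rw [mul_one] at h1
  rw [qf_sub, h1, qf_one, qf_one, sub_nonneg]
  have h2 := (Matrix.toEuclideanCLM (n := F) (𝕜 := ℂ) (toeplitz f)).le_opNorm (WithLp.toLp 2 v)
  have h3 : ‖Matrix.toEuclideanCLM (n := F) (𝕜 := ℂ) (toeplitz f) (WithLp.toLp 2 v)‖
      ≤ ‖WithLp.toLp 2 v‖ :=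
    h2.trans (mul_le_of_le_one_left (norm_nonneg _) h)
  rw [EuclideanSpace.norm_eq, EuclideanSpace.norm_eq] at h3
  have h4 := (Real.sqrt_le_sqrt_iff (by positivity)).1 h3
  simpa using h4

variable (hΨ : IsTestFamily Ψ)
include hΨ

include hF in
theorem IsTestFamily.posSemidef_one_sub {ψ : G → ℂ} (hψ : ψ ∈ Ψ) :
    (1 - (toeplitz fun x : F => ψ x)ᴴ * toeplitz fun x : F => ψ x).PosSemidef :=
  posSemidef_one_sub_of_toeplitzNorm_le (hΨ.contractive F hF ψ hψ)

/-- This is contractivity of the test functions on `ℂ^F`; it allows regularising by `ε • 1` inside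
the cone. -/
theorem IsTestFamily.one_mem_cone : (1 : Matrix F F ℂ) ∈ (lowerAlg F hF).cone (testSet Ψ F) :=
  (mem_cone_iff hF).2 ⟨.one, fun ψ hψ => by simpa using hΨ.posSemidef_one_sub hF hψ⟩

theorem IsTestFamily.add_smul_one_mem_cone {L : Matrix F F ℂ}
    (hL : L ∈ (lowerAlg F hF).cone (testSet Ψ F)) {ε : ℝ} (hε : 0 ≤ ε) :
    L + (ε : ℂ) • 1 ∈ (lowerAlg F hF).cone (testSet Ψ F) :=
  LeftRegular.add_mem_cone hL (LeftRegular.smul_mem_cone (hΨ.one_mem_cone hF) hε)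

theorem IsTestFamily.exists_bound (f : F → ℂ) : ∃ C : ℝ, 0 ≤ C ∧
    ∀ L ∈ (lowerAlg F hF).cone (testSet Ψ F), qf L f ≤ C * qf L (lowerAlg F hF).unit := by
  refine LeftRegular.exists_bound (fun M h1 h2 h3 => ?_) f
  refine hΨ.generates F hF M h1 (fun ψ hψ => h2 ⟨ψ, hψ, rfl⟩) fun f hf g hg => ?_
  rw [conv_eq_mulVec]
  exact h3 f hf g hg

omit hΨ

include hF in
theorem of_starProd_restrict (c : ℂ) (φ : G → ℂ) (k : G → G → ℂ) :
    (Matrix.of fun a b : F =>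
        starProd (fun p q : G => c * unitKer p q - φ p * star (φ q)) k (a : G) b)
      = c • (Matrix.of fun a b : F => k a b) - (toeplitz fun x : F => φ x) *
        (Matrix.of fun a b : F => k a b) * (toeplitz fun x : F => φ x)ᴴ := by
  rw [← starProd_unitKer_sub hF]
  ext a b
  exact starProd_restrict hF (fun p q => c * unitKer p q - φ p * star (φ q)) k a b

include hF in
theorem of_starProd_restrict_one (φ : G → ℂ) (k : G → G → ℂ) :
    (Matrix.of fun a b : F =>
        starProd (fun p q : G => unitKer p q - φ p * star (φ q)) k (a : G) b)
      = (Matrix.of fun a b : F => k a b) - (toeplitz fun x : F => φ x) *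
        (Matrix.of fun a b : F => k a b) * (toeplitz fun x : F => φ x)ᴴ := by
  simpa only [one_mul, one_smul] using of_starProd_restrict hF 1 φ k

end LowerSets

/-! ### Enlarging the lower set: forms extended by zero, kernels extended to `G`. -/

section Inclusion
variable {G : Type*} {F F' : Finset G}

/-- The matrix of the inclusion of the functions on `F` into the functions on `F'`. -/
noncomputable def inclMatrix (F F' : Finset G) : Matrix F' F ℂ :=
  Matrix.of fun a b => if (a : G) = b then 1 else 0

theorem conjTranspose_inclMatrix_mul {m : Type*} (h : F ⊆ F') (X : Matrix F' m ℂ) :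
    (inclMatrix F F')ᴴ * X = X.submatrix (fun a : F => (⟨a, h a.2⟩ : F')) id := by
  ext a b
  rw [mul_apply, Finset.sum_eq_single ⟨a, h a.2⟩]
  · simp [inclMatrix]
  · intro c _ hc
    have : (c : G) ≠ a := fun hca => hc (Subtype.ext hca)
    simp [inclMatrix, this]
  · simp

theorem conjTranspose_inclMatrix_mul_mul (h : F ⊆ F') (X : Matrix F' F' ℂ) :
    (inclMatrix F F')ᴴ * X * inclMatrix F F'
      = X.submatrix (fun a : F => (⟨a, h a.2⟩ : F')) (fun a : F => (⟨a, h a.2⟩ : F')) := by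
  have h1 : (inclMatrix F F')ᴴ * X * inclMatrix F F'
      = ((inclMatrix F F')ᴴ * ((inclMatrix F F')ᴴ * X)ᴴ)ᴴ := by
    rw [conjTranspose_mul, conjTranspose_conjTranspose, conjTranspose_conjTranspose]
  rw [h1, conjTranspose_inclMatrix_mul h, conjTranspose_inclMatrix_mul h]
  ext a b
  simp

theorem conjTranspose_inclMatrix_mulVec (h : F ⊆ F') (v : F' → ℂ) :
    (inclMatrix F F')ᴴ *ᵥ v = fun a : F => v ⟨a, h a.2⟩ := by
  ext a
  rw [mulVec, dotProduct, Finset.sum_eq_single ⟨a, h a.2⟩]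
  · simp [inclMatrix]
  · intro c _ hc
    have : (c : G) ≠ a := fun hca => hc (Subtype.ext hca)
    simp [inclMatrix, this]
  · simp

theorem conjTranspose_inclMatrix_mul_self (h : F ⊆ F') :
    (inclMatrix F F')ᴴ * inclMatrix F F' = 1 := by
  rw [conjTranspose_inclMatrix_mul h]
  ext a b
  by_cases hab : a = b
  · subst hab
    simp [inclMatrix]
  · have : (a : G) ≠ b := fun h => hab (Subtype.ext h)
    simp [hab, inclMatrix, this]

theorem inclMatrix_self : inclMatrix F F = 1 := by
  ext a b
  by_cases hab : a = b
  · subst hab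
    simp [inclMatrix]
  · have : (a : G) ≠ b := fun h => hab (Subtype.ext h)
    simp [hab, inclMatrix]

theorem inclMatrix_mul_mul_apply (L : Matrix F F ℂ) (a b : F') :
    (inclMatrix F F' * L * (inclMatrix F F')ᴴ) a b
      = if h : (a : G) ∈ F ∧ (b : G) ∈ F then L ⟨a, h.1⟩ ⟨b, h.2⟩ else 0 := by
  have hz : ∀ (c : F') (d : F), (c : G) ∉ F → (c : G) ≠ d := fun c d hc h => hc (h ▸ d.2)
  simp only [mul_apply, conjTranspose_apply]
  split_ifs with h
  · rw [Finset.sum_eq_single ⟨b, h.2⟩, Finset.sum_eq_single ⟨a, h.1⟩]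
    · simp [inclMatrix]
    · intro c _ hc
      have : (a : G) ≠ c := fun hca => hc (Subtype.ext hca.symm)
      simp [inclMatrix, this]
    · simp
    · intro c _ hc
      have : (b : G) ≠ c := fun hca => hc (Subtype.ext hca.symm)
      simp [inclMatrix, this]
    · simp
  · rw [not_and_or] at h
    refine Finset.sum_eq_zero fun c _ => ?_
    rcases h with h | h
    · rw [Finset.sum_eq_zero, zero_mul]
      intro d _
      simp [inclMatrix, hz a d h]
    · simp [inclMatrix, hz b c h]

variable [Semigroupoid G]

/-- Values of a convolution on a lower set involve only values on that set, so restriction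
intertwines the left multiplications. -/
theorem conjTranspose_inclMatrix_mul_toeplitz (hF : IsLower (F : Set G)) (h : F ⊆ F')
    (f : F' → ℂ) : (inclMatrix F F')ᴴ * toeplitz f
      = toeplitz (fun x : F => f ⟨x, h x.2⟩) * (inclMatrix F F')ᴴ := by
  rw [conjTranspose_inclMatrix_mul h]
  ext a b
  rw [mul_apply, submatrix_apply, id, toeplitz_apply]
  have hsum : (∑ c : F', if IsProd (c : G) b a then f c else 0)
      = ∑ c : F, if IsProd (c : G) b a then f ⟨c, h c.2⟩ else 0 := by
    refine (Finset.sum_of_injOn (fun c : F => (⟨c, h c.2⟩ : F')) ?_ ?_ ?_ ?_).symm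
    · intro c _ d _ hcd
      exact Subtype.ext (congrArg (fun x : F' => (x : G)) hcd)
    · simp
    · intro c _ hc
      rw [if_neg]
      intro hp
      exact hc ⟨⟨c, hF a a.2 c (IsProd.below_left hp)⟩, by simp⟩
    · intro c _
      rfl
  rw [hsum]
  by_cases hb : (b : G) ∈ F
  · rw [Finset.sum_eq_single (a := (⟨b, hb⟩ : F))
      (f := fun j => toeplitz (fun x : F => f ⟨x, h x.2⟩) a j * (inclMatrix F F')ᴴ j b)]
    · simp [inclMatrix, toeplitz_apply]
    · intro c _ hc
      have : (b : G) ≠ c := fun hca => hc (Subtype.ext hca.symm)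
      simp [inclMatrix, this]
    · simp
  · rw [Finset.sum_eq_zero, Finset.sum_eq_zero]
    · intro c _
      have : (b : G) ≠ c := fun hbc => hb (hbc ▸ c.2)
      simp [inclMatrix, this]
    · intro c _
      rw [if_neg]
      intro hp
      exact hb (hF a a.2 b (IsProd.below_right hp))

variable {Ψ : Set (G → ℂ)} (hF : IsLower (F : Set G)) (hF' : IsLower (F' : Set G))

/-- Extension by zero of the forms in the cone. -/
theorem incl_mem_cone (h : F ⊆ F') {L : Matrix F F ℂ}
    (hL : L ∈ (lowerAlg F hF).cone (testSet Ψ F)) :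
    inclMatrix F F' * L * (inclMatrix F F')ᴴ ∈ (lowerAlg F' hF').cone (testSet Ψ F') := by
  rw [mem_cone_iff] at hL ⊢
  refine ⟨hL.1.mul_mul_conjTranspose_same _, fun ψ hψ => ?_⟩
  convert (hL.2 ψ hψ).mul_mul_conjTranspose_same (inclMatrix F F') using 1
  have h1 := conjTranspose_inclMatrix_mul_toeplitz hF h (fun x : F' => ψ x)
  have h2 := congrArg conjTranspose h1
  rw [conjTranspose_mul, conjTranspose_mul, conjTranspose_conjTranspose] at h2
  rw [Matrix.mul_sub, Matrix.sub_mul]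
  congr 1
  rw [← Matrix.mul_assoc, ← Matrix.mul_assoc, h2, Matrix.mul_assoc _ _ (toeplitz _), h1]
  simp only [Matrix.mul_assoc]

/-- Restrictions of members of the unit ball are in the unit ball. -/
theorem restrict_mem_ball (h : F ⊆ F') {f : F' → ℂ}
    (hf : f ∈ (lowerAlg F' hF').ball (testSet Ψ F')) :
    (fun x : F => f ⟨x, h x.2⟩) ∈ (lowerAlg F hF).ball (testSet Ψ F) := by
  intro L hL
  have := hf _ (incl_mem_cone hF hF' h hL)
  have hq : ∀ v, qf (inclMatrix F F' * L * (inclMatrix F F')ᴴ) v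
      = qf L (fun a : F => v ⟨a, h a.2⟩) := fun v => by
    rw [← conjTranspose_inclMatrix_mulVec h, ← qf_conjTranspose_mul_mul,
      conjTranspose_conjTranspose]
  rwa [hq, hq] at this

/-- The kernel on `G` which on `F` is `(L + ε)⁻¹` and off `F` is `ε⁻¹` times the identity. -/
noncomputable def extKernel (L : Matrix F F ℂ) (ε : ℝ) (a b : G) : ℂ :=
  (if a = b then (ε : ℂ)⁻¹ else 0) - if h : a ∈ F ∧ b ∈ F then
    ((ε : ℂ)⁻¹ • (L * (L + (ε : ℂ) • 1)⁻¹)) ⟨a, h.1⟩ ⟨b, h.2⟩ else 0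

theorem posDef_add_smul_one {n : Type*} [DecidableEq n] {L : Matrix n n ℂ}
    (hL : L.PosSemidef) {ε : ℝ} (hε : 0 < ε) : (L + (ε : ℂ) • 1).PosDef :=
  (posDef_smul_one hε).posSemidef_add hL

-- The inverse is `ε⁻¹ - JNJ*` with `N = ε⁻¹ L (L + ε)⁻¹` independent of `F'`. Thus the inverses for
-- the various `F'` are restrictions of one kernel on `G`.
omit [Semigroupoid G] in
theorem extKernel_restrict (h : F ⊆ F') {L : Matrix F F ℂ} (hL : L.PosSemidef) {ε : ℝ}
    (hε : 0 < ε) : (Matrix.of fun a b : F' => extKernel L ε a b)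
      = (inclMatrix F F' * L * (inclMatrix F F')ᴴ + (ε : ℂ) • 1)⁻¹ := by
  have hε' : (ε : ℂ) ≠ 0 := by exact_mod_cast hε.ne'
  set J := inclMatrix F F' with hJ
  set N := (ε : ℂ)⁻¹ • (L * (L + (ε : ℂ) • 1)⁻¹) with hN
  have h1 : (Matrix.of fun a b : F' => extKernel L ε a b) = (ε : ℂ)⁻¹ • 1 - J * N * Jᴴ := by
    ext a b
    rw [Matrix.of_apply, Matrix.sub_apply, inclMatrix_mul_mul_apply, extKernel]
    by_cases hab : a = b
    · subst hab
      simp [hN]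
    · have : (a : G) ≠ b := fun h => hab (Subtype.ext h)
      simp [hab, this, hN]
  have hdet := (isUnit_iff_isUnit_det _).1 (posDef_add_smul_one hL hε).isUnit
  have hcomm : L * (L + (ε : ℂ) • 1) = (L + (ε : ℂ) • 1) * L := by simp [mul_add, add_mul]
  have h2 : (L + (ε : ℂ) • 1) * N = (ε : ℂ)⁻¹ • L := by
    rw [hN, Matrix.mul_smul, ← Matrix.mul_assoc, ← hcomm, Matrix.mul_assoc,
      mul_nonsing_inv _ hdet, Matrix.mul_one]
  have h3 : J * L * Jᴴ * (J * N * Jᴴ) = J * (L * N) * Jᴴ := by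
    calc J * L * Jᴴ * (J * N * Jᴴ) = J * L * (Jᴴ * J) * N * Jᴴ := by simp only [Matrix.mul_assoc]
      _ = _ := by
        rw [conjTranspose_inclMatrix_mul_self h, Matrix.mul_one]
        simp only [Matrix.mul_assoc]
  have h4 : L * N = (ε : ℂ)⁻¹ • L - (ε : ℂ) • N := by
    rw [← h2, Matrix.add_mul, Matrix.smul_mul, one_mul, add_sub_cancel_right]
  rw [h1]
  refine (inv_eq_right_inv ?_).symm
  rw [mul_sub, Matrix.add_mul, Matrix.add_mul, h3, h4]
  simp only [Matrix.mul_smul, Matrix.smul_mul, Matrix.mul_one, one_mul, Matrix.mul_sub, Matrix.sub_mul,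
    smul_smul,
    inv_mul_cancel₀ hε', one_smul]
  abel

/-- On each lower set containing `F` the kernel is the inverse of an invertible member of the cone
there, so Schur complements turn the cone inequalities into the kernel inequalities. -/
theorem extKernel_mem_kernels (hΨ : IsTestFamily Ψ) {L : Matrix F F ℂ}
    (hL : L ∈ (lowerAlg F hF).cone (testSet Ψ F)) {ε : ℝ} (hε : 0 < ε) :
    extKernel L ε ∈ kernels Ψ := by
  have key : ∀ F' : Finset G, F ⊆ F' → (hF' : IsLower (F' : Set G)) →
      inclMatrix F F' * L * (inclMatrix F F')ᴴ + (ε : ℂ) • 1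
        ∈ (lowerAlg F' hF').cone (testSet Ψ F') := fun F' hFF' hF' =>
    hΨ.add_smul_one_mem_cone hF' (incl_mem_cone hF hF' hFF' hL) hε.le
  have hpd : ∀ F' : Finset G,
      (inclMatrix F F' * L * (inclMatrix F F')ᴴ + (ε : ℂ) • 1).PosDef := fun F' =>
    posDef_add_smul_one (hL.1.mul_mul_conjTranspose_same _) hε
  refine ⟨isPosKernel_of_forall_isLower F hF fun F' hFF' hF' => ?_, fun ψ hψ =>
    isPosKernel_of_forall_isLower F hF fun F' hFF' hF' => ?_⟩
  · rw [extKernel_restrict hFF' hL.1 hε]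
    exact (hpd F').inv.posSemidef
  · rw [of_starProd_restrict_one hF' ψ (extKernel L ε), extKernel_restrict hFF' hL.1 hε,
      posSemidef_sub_conj_iff (hpd F').inv,
      nonsing_inv_nonsing_inv _ ((isUnit_iff_isUnit_det _).1 (hpd F').isUnit)]
    exact ((mem_cone_iff hF').1 (key F' hFF' hF')).2 ψ hψ

end Inclusion
-- The kernel condition as membership in the ball, and extension to a larger finite lower set.
section Interpolation
variable {G : Type*} [Semigroupoid G] {Ψ : Set (G → ℂ)} {F F' : Finset G}
  (hF : IsLower (F : Set G)) (hF' : IsLower (F' : Set G)) (hΨ : IsTestFamily Ψ)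

theorem posSemidef_one_sub_mul_conjTranspose {n : Type*} [Fintype n] [DecidableEq n]
    {T : Matrix n n ℂ} (h : (1 - Tᴴ * T).PosSemidef) : (1 - T * Tᴴ).PosSemidef := by
  have := posSemidef_sub_conj_iff (PosDef.one (n := n) (R := ℂ)) T
  simp only [inv_one, mul_one] at this
  exact this.2 h

include hΨ

theorem one_sub_posSemidef_of_mem_ball {f : F → ℂ}
    (hf : f ∈ (lowerAlg F hF).ball (testSet Ψ F)) :
    (1 - (toeplitz f)ᴴ * toeplitz f).PosSemidef := by
  have := LeftRegular.posSemidef_of_mem_ball hf (hΨ.one_mem_cone hF)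
  rwa [mul_one] at this

/-- For `f` in the unit ball, `([1] - ff*) ⋆ k` is positive for all `k` in `𝒦_Ψ`. -/
theorem posSemidef_of_mem_ball_of_mem_kernels {f : F → ℂ}
    (hf : f ∈ (lowerAlg F hF).ball (testSet Ψ F)) {k : G → G → ℂ} (hk : k ∈ kernels Ψ) :
    ((Matrix.of fun a b : F => k a b) - toeplitz f * (Matrix.of fun a b : F => k a b) *
      (toeplitz f)ᴴ).PosSemidef := by
  set K : Matrix F F ℂ := Matrix.of fun a b : F => k a b with hK
  have hKp : K.PosSemidef := hk.1 F
  refine posSemidef_of_add_smul (N := 1 - toeplitz f * (toeplitz f)ᴴ) fun ε hε => ?_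
  have hpd := posDef_add_smul_one hKp hε
  have hsplit : ∀ T : Matrix F F ℂ, K - T * K * Tᴴ + (ε : ℂ) • (1 - T * Tᴴ)
      = (K + (ε : ℂ) • 1) - T * (K + (ε : ℂ) • 1) * Tᴴ := fun T => by
    simp only [mul_add, add_mul, Matrix.mul_smul, Matrix.smul_mul, mul_one, smul_sub]
    abel
  -- The regularised kernel keeps the test inequalities because each `T_ψ` is a contraction, so its
  -- inverse is a form to which the ball condition applies.
  have hcone : (K + (ε : ℂ) • 1)⁻¹ ∈ (lowerAlg F hF).cone (testSet Ψ F) := by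
    refine (mem_cone_iff hF).2 ⟨hpd.inv.posSemidef, fun ψ hψ => ?_⟩
    rw [← posSemidef_sub_conj_iff hpd, ← hsplit]
    have h1 : (Matrix.of fun a b : F =>
        starProd (fun p q : G => unitKer p q - ψ p * star (ψ q)) k (a : G) b).PosSemidef :=
      hk.2 ψ hψ F
    rw [of_starProd_restrict_one hF] at h1
    have hε' : (0 : ℂ) ≤ ε := by exact_mod_cast hε.le
    exact h1.add ((posSemidef_one_sub_mul_conjTranspose (hΨ.posSemidef_one_sub hF hψ)).smul hε')
  rw [hsplit, posSemidef_sub_conj_iff hpd]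
  exact LeftRegular.posSemidef_of_mem_ball hf hcone

/-- The kernels `extKernel L ε` restrict to `(L + ε)⁻¹` on `F`. Inverting and letting `ε → 0` gives
`L - T_f* L T_f ≥ 0`, which is evaluated at the unit. -/
theorem mem_ball_of_forall_kernels {f : F → ℂ} (h : ∀ k ∈ kernels Ψ,
    ((Matrix.of fun a b : F => k a b) - toeplitz f * (Matrix.of fun a b : F => k a b) *
      (toeplitz f)ᴴ).PosSemidef) : f ∈ (lowerAlg F hF).ball (testSet Ψ F) := by
  intro L hL
  have key : (L - (toeplitz f)ᴴ * L * toeplitz f).PosSemidef := by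
    refine posSemidef_of_add_smul (N := 1 - (toeplitz f)ᴴ * toeplitz f) fun ε hε => ?_
    have hpd := posDef_add_smul_one hL.1 hε
    have h1 := h _ (extKernel_mem_kernels hF hΨ hL hε)
    rw [extKernel_restrict subset_rfl hL.1 hε, inclMatrix_self, one_mul, conjTranspose_one,
      mul_one, posSemidef_sub_conj_iff hpd.inv,
      nonsing_inv_nonsing_inv _ ((isUnit_iff_isUnit_det _).1 hpd.isUnit)] at h1
    convert h1 using 1
    simp only [mul_add, add_mul, Matrix.mul_smul, Matrix.smul_mul, mul_one, smul_sub]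
    abel
  have := key.qf_nonneg (lowerAlg F hF).unit
  rw [qf_sub, qf_conjTranspose_mul_mul] at this
  have h2 : toeplitz f *ᵥ (lowerAlg F hF).unit = f := (lowerAlg F hF).mulVec_unit f
  rw [h2] at this
  linarith

/-- The kernel condition on `F` is membership in the unit ball. -/
theorem forall_kernels_iff_mem_ball {f : F → ℂ} :
    (∀ k ∈ kernels Ψ, IsPosKernel (starProd
        (fun p q : F => unitKer (p : G) (q : G) - f p * star (f q)) (fun p q : F => k p q))) ↔
      f ∈ (lowerAlg F hF).ball (testSet Ψ F) := by
  have : ∀ k : G → G → ℂ, IsPosKernel (starProd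
      (fun p q : F => unitKer (p : G) (q : G) - f p * star (f q)) (fun p q : F => k p q)) ↔
      ((Matrix.of fun a b : F => k a b) - toeplitz f * (Matrix.of fun a b : F => k a b) *
        (toeplitz f)ᴴ).PosSemidef := fun k => by
    rw [isPosKernel_iff_posSemidef]
    have := starProd_unitKer_sub hF 1 f (fun p q : F => k p q)
    simp only [one_mul, one_smul] at this
    rw [this]
  simp only [this]
  exact ⟨mem_ball_of_forall_kernels hF hΨ,
    fun h k hk => posSemidef_of_mem_ball_of_mem_kernels hF hΨ h hk⟩

/-- Members of the unit ball on `F` extend to members of the unit ball on larger lower sets. -/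
theorem exists_extension (h : F ⊆ F') {f : F → ℂ}
    (hf : f ∈ (lowerAlg F hF).ball (testSet Ψ F)) :
    ∃ g ∈ (lowerAlg F' hF').ball (testSet Ψ F'), ∀ x : F, g ⟨x, h x.2⟩ = f x := by
  set B' := (lowerAlg F' hF').ball (testSet Ψ F') with hB'
  let ρ : (F' → ℂ) →ₗ[ℝ] (F → ℂ) := LinearMap.funLeft ℝ ℂ fun x : F => (⟨x, h x.2⟩ : F')
  have hρ : Continuous ρ := continuous_pi fun x => continuous_apply _
  have hcomp : IsCompact (ρ '' B') := by
    refine IsCompact.image (LeftRegular.isCompact_ball ?_) hρ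
    rintro _ ⟨ψ, hψ, rfl⟩
    exact hΨ.posSemidef_one_sub hF' hψ
  by_contra hcon
  have hfn : f ∉ ρ '' B' := by
    rintro ⟨g, hg, hgf⟩
    exact hcon ⟨g, hg, fun x => congrFun hgf x⟩
  obtain ⟨φ, c, h1, h2⟩ := RCLike.geometric_hahn_banach_closed_point (𝕜 := ℂ)
    (LeftRegular.convex_ball.linear_image ρ) hcomp.isClosed hfn
  have hc : 0 < c := by
    have := h1 _ (Set.mem_image_of_mem ρ LeftRegular.zero_mem_ball)
    simpa using this
  set u : F → ℂ := fun x => star ((c : ℂ)⁻¹ * φ (Pi.single x 1)) with hu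
  have hφ : ∀ a : F → ℂ, star u ⬝ᵥ a = (c : ℂ)⁻¹ * φ a := fun a => by
    have : a = ∑ x, a x • (Pi.single x 1 : F → ℂ) := by
      ext y
      simp [Finset.sum_apply, Pi.single_apply]
    conv_rhs => rw [this, map_sum, Finset.mul_sum]
    refine Finset.sum_congr rfl fun x _ => ?_
    rw [map_smul, smul_eq_mul, hu, Pi.star_apply, star_star]
    ring
  set J := inclMatrix F F' with hJ
  have hJstar : ∀ (w : F → ℂ) (v : F' → ℂ), star (J *ᵥ w) ⬝ᵥ v = star w ⬝ᵥ (Jᴴ *ᵥ v) :=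
    fun w v => by rw [star_mulVec, dotProduct_mulVec]
  have hbound : ∀ g ∈ B', ‖star (J *ᵥ u) ⬝ᵥ g‖ ≤ 1 := fun g hg => by
    rw [hJstar, conjTranspose_inclMatrix_mulVec h, hφ, norm_mul, norm_inv, Complex.norm_real,
      Real.norm_of_nonneg hc.le, inv_mul_le_iff₀ hc, mul_one]
    set z := φ fun a : F => g ⟨a, h a.2⟩ with hz
    by_cases hz0 : z = 0
    · rw [hz0, norm_zero]; exact hc.le
    have hzn : (‖z‖ : ℂ) ≠ 0 := by exact_mod_cast norm_ne_zero_iff.2 hz0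
    -- Separation bounds only real parts; rotating `g` by the phase of `z` gives the bound on the
    -- modulus.
    have hmem : (star z / ‖z‖ : ℂ) • g ∈ B' := by
      refine LeftRegular.smul_mem_ball hg ?_
      rw [norm_div, norm_star, Complex.norm_real, norm_norm]
      exact div_self_le_one _
    have h3 := h1 _ (Set.mem_image_of_mem ρ hmem)
    have h4 : φ (ρ ((star z / ‖z‖ : ℂ) • g)) = (‖z‖ : ℂ) := by
      have : ρ ((star z / ‖z‖ : ℂ) • g) = (star z / ‖z‖ : ℂ) • fun a : F => g ⟨a, h a.2⟩ := rfl
      rw [this, map_smul, smul_eq_mul, ← hz, div_mul_eq_mul_div, div_eq_iff hzn,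
        Complex.star_def, ← Complex.normSq_eq_conj_mul_self, Complex.normSq_eq_norm_sq]
      push_cast
      ring
    rw [h4] at h3
    exact (by simpa using h3.le)
  obtain ⟨L, hL, hL1, hLu⟩ := LeftRegular.exists_dominating (hΨ.exists_bound hF') _ hbound
  have hkey : ∀ ε : ℝ, 0 < ε →
      -- With `k = (L + ε)⁻¹`: domination gives `k(u,u) ≤ 1`, the kernel condition for `f` gives
      -- `k(T_f*u, T_f*u) ≤ k(u,u)`, and Cauchy–Schwarz pairs `T_f*u` with the unit to recover `⟨u,
      -- f⟩`.
      ‖star u ⬝ᵥ f‖ ^ 2 ≤ 1 + ε * qf 1 (lowerAlg F' hF').unit := fun ε hε => by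
    have hpd := posDef_add_smul_one hL.1 hε
    have hdet := (isUnit_iff_isUnit_det _).1 hpd.isUnit
    have h3 := posSemidef_of_mem_ball_of_mem_kernels hF hΨ hf
      (extKernel_mem_kernels hF' hΨ hL hε)
    have h4 : (Matrix.of fun a b : F => extKernel L ε a b)
        = Jᴴ * (L + (ε : ℂ) • 1)⁻¹ * J := by
      have h5 := extKernel_restrict subset_rfl hL.1 hε
      rw [inclMatrix_self, one_mul, conjTranspose_one, mul_one] at h5
      rw [← h5, hJ, conjTranspose_inclMatrix_mul_mul h]
      rfl
    rw [h4] at h3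
    have h5 := h3.qf_nonneg u
    rw [qf_sub, qf_conjTranspose_mul_mul] at h5
    have h6 : qf (toeplitz f * (Jᴴ * (L + (ε : ℂ) • 1)⁻¹ * J) * (toeplitz f)ᴴ) u
        = qf (L + (ε : ℂ) • 1)⁻¹ (J *ᵥ ((toeplitz f)ᴴ *ᵥ u)) := by
      rw [← qf_conjTranspose_mul_mul, ← qf_conjTranspose_mul_mul, conjTranspose_conjTranspose]
    rw [h6] at h5
    have h7 : qf (L + (ε : ℂ) • 1)⁻¹ (J *ᵥ u) ≤ 1 := by
      refine qf_inv_le hpd one_pos fun v => ?_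
      rw [one_mul, qf_add, qf_smul]
      have := (PosSemidef.one (n := F') (R := ℂ)).qf_nonneg v
      have := mul_nonneg hε.le this
      linarith [hLu v]
    have h8 := dotProduct_sq_le hpd (J *ᵥ ((toeplitz f)ᴴ *ᵥ u)) (lowerAlg F' hF').unit
    have h9 : star (J *ᵥ ((toeplitz f)ᴴ *ᵥ u)) ⬝ᵥ (lowerAlg F' hF').unit = star u ⬝ᵥ f := by
      rw [hJstar, conjTranspose_inclMatrix_mulVec h, star_mulVec, conjTranspose_conjTranspose,
        ← dotProduct_mulVec]
      congr 1
      exact toeplitz_mulVec_delta hF f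
    rw [h9, qf_add, qf_smul] at h8
    have h10 : 0 ≤ qf (1 : Matrix F' F' ℂ) (lowerAlg F' hF').unit :=
      PosSemidef.one.qf_nonneg _
    have h11 : qf L (lowerAlg F' hF').unit + ε * qf 1 (lowerAlg F' hF').unit
        ≤ 1 + ε * qf 1 (lowerAlg F' hF').unit := by linarith
    have h12 := hL.1.qf_nonneg (lowerAlg F' hF').unit
    refine h8.trans ?_
    calc _ ≤ (1 + ε * qf 1 (lowerAlg F' hF').unit) * 1 :=
          mul_le_mul h11 (by linarith) (hpd.inv.posSemidef.qf_nonneg _) (by positivity)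
      _ = _ := mul_one _
  have hle : ‖star u ⬝ᵥ f‖ ^ 2 ≤ 1 := by
    have h10 : 0 ≤ qf (1 : Matrix F' F' ℂ) (lowerAlg F' hF').unit :=
      PosSemidef.one.qf_nonneg _
    refine le_of_forall_pos_le_add fun δ hδ => ?_
    refine (hkey (δ / (qf 1 (lowerAlg F' hF').unit + 1)) (by positivity)).trans ?_
    rw [div_mul_eq_mul_div]
    gcongr
    rw [div_le_iff₀ (by positivity)]
    nlinarith
  rw [hφ, norm_mul, norm_inv, Complex.norm_real, Real.norm_of_nonneg hc.le] at hle
  have h13 : c⁻¹ * ‖φ f‖ ≤ 1 := by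
    by_contra! h
    nlinarith
  rw [inv_mul_le_iff₀ hc, mul_one] at h13
  have : RCLike.re (φ f) ≤ ‖φ f‖ := RCLike.re_le_norm _
  linarith

end Interpolation
-- Extension to all of `G` and equality of the norms.
section Extension
variable {G : Type*} [Semigroupoid G] {Ψ : Set (G → ℂ)} {F : Finset G}
  (hF : IsLower (F : Set G)) (hΨ : IsTestFamily Ψ)

theorem toeplitz_apply_of_isIdem (f : F → ℂ) {a e : F} (he : IsIdem (e : G))
    (hae : IsProd (a : G) e a) : toeplitz f a e = f a := by
  rw [toeplitz_apply, Finset.sum_eq_single a]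
  · simp [hae]
  · intro c _ hc
    rw [if_neg]
    intro h
    exact hc (Subtype.ext (he.2 _ _ h).symm)
  · simp

include hΨ

/-- The value `f x` is an entry in the column of the contraction `toeplitz f` at the right unit of
`x`. This pointwise bound puts extensions in a compact product of discs. -/
theorem norm_le_one_of_mem_ball {f : F → ℂ}
    (hf : f ∈ (lowerAlg F hF).ball (testSet Ψ F)) (x : F) : ‖f x‖ ≤ 1 := by
  obtain ⟨-, e, -, he, -, hxe⟩ := Semigroupoid.exists_idem (x : G)
  set e' : F := ⟨e, hF x x.2 e (IsProd.below_right hxe)⟩ with he'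
  have h1 := (one_sub_posSemidef_of_mem_ball hF hΨ hf).qf_nonneg (Pi.single e' 1)
  have h2 := qf_conjTranspose_mul_mul 1 (toeplitz f) (Pi.single e' 1)
  rw [mul_one] at h2
  rw [qf_sub, h2, qf_one, qf_one, mulVec_single_one] at h1
  have h3 : ∑ i : F, ‖(Pi.single e' 1 : F → ℂ) i‖ ^ 2 = 1 := by
    rw [Finset.sum_eq_single e']
    · simp
    · intro i _ hi
      simp [hi]
    · simp
  have h4 : ‖f x‖ ^ 2 ≤ ∑ i : F, ‖(toeplitz f).col e' i‖ ^ 2 := by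
    have := Finset.single_le_sum (f := fun i : F => ‖(toeplitz f).col e' i‖ ^ 2)
      (fun i _ => by positivity) (Finset.mem_univ x)
    simp only [col_apply] at this ⊢
    rwa [toeplitz_apply_of_isIdem f he hxe] at this
  by_contra! h
  nlinarith

/-- Scaled version of `forall_kernels_iff_mem_ball`. -/
theorem forall_kernels_iff_smul_mem_ball {f : F → ℂ} {C : ℝ} (hC : 0 < C) :
    (∀ k ∈ kernels Ψ, IsPosKernel (starProd
        (fun p q : F => (C : ℂ) ^ 2 * unitKer (p : G) (q : G) - f p * star (f q))
        (fun p q : F => k p q))) ↔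
      (C : ℂ)⁻¹ • f ∈ (lowerAlg F hF).ball (testSet Ψ F) := by
  have hC' : (C : ℂ) ≠ 0 := by exact_mod_cast hC.ne'
  rw [← forall_kernels_iff_mem_ball hF hΨ]
  refine forall₂_congr fun k _ => ?_
  rw [isPosKernel_iff_posSemidef, isPosKernel_iff_posSemidef]
  have h1 := starProd_unitKer_sub hF ((C : ℂ) ^ 2) f (fun p q : F => k p q)
  have h2 := starProd_unitKer_sub hF 1 ((C : ℂ)⁻¹ • f) (fun p q : F => k p q)
  simp only [one_mul, one_smul] at h2
  rw [h1, h2]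
  have h3 : toeplitz ((C : ℂ)⁻¹ • f) = (C : ℂ)⁻¹ • toeplitz f := (toeplitzLin F).map_smul _ _
  set K : Matrix F F ℂ := Matrix.of fun p q : F => k p q with hK
  have h4 : (C : ℂ) ^ 2 • K - toeplitz f * K * (toeplitz f)ᴴ = (C : ℂ) ^ 2 •
      (K - toeplitz ((C : ℂ)⁻¹ • f) * K * (toeplitz ((C : ℂ)⁻¹ • f))ᴴ) := by
    have h5 : star (C : ℂ)⁻¹ = (C : ℂ)⁻¹ := by simp
    rw [h3, conjTranspose_smul, h5, smul_sub, Matrix.smul_mul, Matrix.smul_mul, Matrix.mul_smul,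
      smul_smul, smul_smul]
    have : (C : ℂ) ^ 2 * (C : ℂ)⁻¹ * (C : ℂ)⁻¹ = 1 := by field_simp
    rw [this, one_smul]
  rw [h4]
  have h6 : (0 : ℂ) ≤ (C : ℂ) ^ 2 := by exact_mod_cast (sq_nonneg C)
  refine ⟨fun h => ?_, fun h => h.smul h6⟩
  have h7 : (0 : ℂ) ≤ ((C : ℂ) ^ 2)⁻¹ := by exact_mod_cast (inv_nonneg.2 (sq_nonneg C))
  have := h.smul h7
  rwa [smul_smul, inv_mul_cancel₀ (pow_ne_zero 2 hC'), one_smul] at this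

theorem smul_restrict_mem_ball {φ : G → ℂ} {C : ℝ} (h : C ∈ hInftyBounds Ψ φ) :
    (C : ℂ)⁻¹ • (fun x : F => φ x) ∈ (lowerAlg F hF).ball (testSet Ψ F) := by
  rw [← forall_kernels_iff_smul_mem_ball hF hΨ h.1]
  intro k hk
  rw [isPosKernel_iff_posSemidef]
  have h1 := h.2 k hk F
  have h2 := of_starProd_restrict hF ((C : ℂ) ^ 2) φ k
  rw [starProd_unitKer_sub hF, ← h2]
  exact h1

include hF in
theorem mem_hInftyBounds_of_forall {φ : G → ℂ} {C : ℝ} (hC : 0 < C)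
    (h : ∀ (F' : Finset G) (hF' : IsLower (F' : Set G)), F ⊆ F' →
      (C : ℂ)⁻¹ • (fun x : F' => φ x) ∈ (lowerAlg F' hF').ball (testSet Ψ F')) :
    C ∈ hInftyBounds Ψ φ := by
  refine ⟨hC, fun k hk => isPosKernel_of_forall_isLower F hF fun F' hFF' hF' => ?_⟩
  have h1 := (forall_kernels_iff_smul_mem_ball hF' hΨ hC).2 (h F' hF' hFF') k hk
  rw [isPosKernel_iff_posSemidef, starProd_unitKer_sub hF'] at h1
  rw [of_starProd_restrict hF']
  exact h1

/-- Members of the unit ball on `F` extend to all of `G`. -/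
theorem exists_global_extension {f : F → ℂ}
    (hf : f ∈ (lowerAlg F hF).ball (testSet Ψ F)) :
    ∃ φ : G → ℂ, (∀ x : F, φ x = f x) ∧
      ∀ (F' : Finset G) (hF' : IsLower (F' : Set G)), F ⊆ F' →
        (fun x : F' => φ x) ∈ (lowerAlg F' hF').ball (testSet Ψ F') := by
  let ι := {F' : Finset G // IsLower (F' : Set G) ∧ F ⊆ F'}
  -- Each `Z i` asks for the ball condition on one lower set only. These sets are compact and
  -- directed downwards, since ball conditions restrict; a point common to all is a global
  -- extension.
  let Z : ι → Set (G → ℂ) := fun i => (Set.univ.pi fun _ => Metric.closedBall (0 : ℂ) 1) ∩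
    {φ | (fun x : i.1 => φ x) ∈ (lowerAlg i.1 i.2.1).ball (testSet Ψ i.1)} ∩
    {φ | ∀ x : F, φ x = f x}
  have hne : Nonempty ι := ⟨⟨F, hF, subset_rfl⟩⟩
  have hclosed : ∀ i, IsClosed (Z i) := fun i => by
    refine IsClosed.inter (IsClosed.inter ?_ ?_) ?_
    · exact isClosed_set_pi fun _ _ => Metric.isClosed_closedBall
    · exact LeftRegular.isClosed_ball.preimage (continuous_pi fun x => continuous_apply _)
    · simp only [Set.ofPred_forall]
      exact isClosed_iInter fun x => isClosed_eq (continuous_apply _) continuous_const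
  have hcomp : ∀ i, IsCompact (Z i) := fun i =>
    (isCompact_univ_pi fun _ => isCompact_closedBall (0 : ℂ) 1).of_isClosed_subset (hclosed i)
      (Set.inter_subset_left.trans Set.inter_subset_left)
  have hdir : Directed (· ⊇ ·) Z := fun i j => by
    refine ⟨⟨i.1 ∪ j.1, by rw [Finset.coe_union]; exact i.2.1.union j.2.1,
      i.2.2.trans Finset.subset_union_left⟩, ?_, ?_⟩
    · rintro φ ⟨⟨h1, h2⟩, h3⟩
      exact ⟨⟨h1, restrict_mem_ball i.2.1 _ Finset.subset_union_left h2⟩, h3⟩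
    · rintro φ ⟨⟨h1, h2⟩, h3⟩
      exact ⟨⟨h1, restrict_mem_ball j.2.1 _ Finset.subset_union_right h2⟩, h3⟩
  have hnon : ∀ i, (Z i).Nonempty := fun i => by
    obtain ⟨g, hg, hgf⟩ := exists_extension hF i.2.1 hΨ i.2.2 hf
    refine ⟨fun x => if h : x ∈ i.1 then g ⟨x, h⟩ else 0, ⟨?_, ?_⟩, ?_⟩
    · intro x _
      rw [mem_closedBall_zero_iff]
      dsimp only
      split_ifs with h
      · exact norm_le_one_of_mem_ball i.2.1 hΨ hg _
      · simp
    · simpa using hg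
    · intro x
      simp only [dif_pos (i.2.2 x.2)]
      exact hgf x
  obtain ⟨φ, hφ⟩ := IsCompact.nonempty_iInter_of_directed_nonempty_isCompact_isClosed Z hdir
    hnon hcomp hclosed
  rw [Set.mem_iInter] at hφ
  exact ⟨φ, (hφ ⟨F, hF, subset_rfl⟩).2, fun F' hF' h => (hφ ⟨F', hF', h⟩).1.2⟩

theorem exists_extension_of_smul_mem_ball {f : F → ℂ} {C : ℝ} (hC : 0 < C)
    (hf : (C : ℂ)⁻¹ • f ∈ (lowerAlg F hF).ball (testSet Ψ F)) :
    ∃ φ : G → ℂ, C ∈ hInftyBounds Ψ φ ∧ ∀ x : F, φ x = f x := by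
  have hC' : (C : ℂ) ≠ 0 := by exact_mod_cast hC.ne'
  obtain ⟨φ, h1, h2⟩ := exists_global_extension hF hΨ hf
  refine ⟨(C : ℂ) • φ, mem_hInftyBounds_of_forall hF hΨ hC fun F' hF' h => ?_, fun x => ?_⟩
  · convert h2 F' hF' h using 1
    ext x
    simp [hC']
  · simp [h1, hC']

omit hΨ in
theorem bddBelow_hInftyBounds (φ : G → ℂ) : BddBelow (hInftyBounds Ψ φ) :=
  ⟨0, fun _ h => h.1.le⟩

theorem exists_memHInfty_iff_mem_ball {f : F → ℂ} :
    (∃ φ : G → ℂ, MemHInfty Ψ φ ∧ hInftyNorm Ψ φ ≤ 1 ∧ ∀ x : F, φ x = f x) ↔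
      f ∈ (lowerAlg F hF).ball (testSet Ψ F) := by
  constructor
  · rintro ⟨φ, hφ, hnorm, hf⟩ L hL
    have h0 := hL.1.qf_nonneg (lowerAlg F hF).unit
    -- The norm is an infimum, so a bound is only available below each `C > 1`; afterwards `C → 1`.
    have key : ∀ C : ℝ, 1 < C → qf L f ≤ C ^ 2 * qf L (lowerAlg F hF).unit := fun C hC => by
      obtain ⟨D, hD, hDC⟩ := exists_lt_of_csInf_lt hφ (hnorm.trans_lt hC)
      have h1 := smul_restrict_mem_ball hF hΨ hD L hL
      have h2 : (fun x : F => φ x) = f := funext hf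
      have hD0 : 0 < D := hD.1
      rw [h2, qf_smul_vec, norm_inv, Complex.norm_real, Real.norm_of_nonneg hD0.le, inv_pow,
        inv_mul_le_iff₀ (by positivity)] at h1
      refine h1.trans ?_
      gcongr
    have hc : Continuous fun C : ℝ => C ^ 2 * qf L (lowerAlg F hF).unit := by fun_prop
    have ht := (hc.tendsto 1).mono_left (nhdsWithin_le_nhds (s := Set.Ioi 1))
    rw [one_pow, one_mul] at ht
    exact ge_of_tendsto ht (Filter.eventually_of_mem self_mem_nhdsWithin fun C hC => key C hC)
  · intro hf
    obtain ⟨φ, h1, h2⟩ := exists_extension_of_smul_mem_ball hF hΨ one_pos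
      (f := f) (by simpa using hf)
    exact ⟨φ, ⟨1, h1⟩, csInf_le (bddBelow_hInftyBounds φ) h1, h2⟩

theorem exists_smul_mem_ball (f : F → ℂ) :
    ∃ C : ℝ, 0 < C ∧ (C : ℂ)⁻¹ • f ∈ (lowerAlg F hF).ball (testSet Ψ F) := by
  obtain ⟨C, hC0, hC⟩ := hΨ.exists_bound hF f
  -- The square root appears because forms scale quadratically; adding one keeps the constant
  -- positive.
  refine ⟨√(C + 1), by positivity, fun L hL => ?_⟩
  rw [qf_smul_vec, norm_inv, Complex.norm_real, Real.norm_of_nonneg (by positivity), inv_pow,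
    Real.sq_sqrt (by positivity), inv_mul_le_iff₀ (by positivity)]
  have := hL.1.qf_nonneg (lowerAlg F hF).unit
  nlinarith [hC L hL]

include hF in
theorem exists_memHInfty (f : F → ℂ) : ∃ φ : G → ℂ, MemHInfty Ψ φ ∧ ∀ x : F, φ x = f x := by
  obtain ⟨C, hC, hf⟩ := exists_smul_mem_ball hF hΨ f
  obtain ⟨φ, h1, h2⟩ := exists_extension_of_smul_mem_ball hF hΨ hC hf
  exact ⟨φ, ⟨C, h1⟩, h2⟩

include hF in
-- Each constant admissible on `F` is a bound for some extension, and each bound for an extension is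
-- admissible on `F`.
theorem quotientNorm_eq_kernelNorm (f : F → ℂ) : quotientNorm Ψ F f = kernelNorm Ψ F f := by
  have hnn : ∀ φ : G → ℂ, 0 ≤ hInftyNorm Ψ φ := fun φ => Real.sInf_nonneg fun C hC => hC.1.le
  refine le_antisymm (le_csInf ?_ ?_) (le_csInf ?_ ?_)
  · obtain ⟨C, hC, hf⟩ := exists_smul_mem_ball hF hΨ f
    exact ⟨C, hC, (forall_kernels_iff_smul_mem_ball hF hΨ hC).2 hf⟩
  · rintro C ⟨hC, hf⟩
    obtain ⟨φ, h1, h2⟩ := exists_extension_of_smul_mem_ball hF hΨ hC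
      ((forall_kernels_iff_smul_mem_ball hF hΨ hC).1 hf)
    have hbdd : BddBelow {r | ∃ φ : G → ℂ, MemHInfty Ψ φ ∧ (∀ x : F, φ x = f x) ∧
        hInftyNorm Ψ φ = r} := ⟨0, by
      rintro _ ⟨φ, -, -, rfl⟩
      exact hnn φ⟩
    exact (csInf_le hbdd ⟨φ, ⟨C, h1⟩, h2, rfl⟩).trans (csInf_le (bddBelow_hInftyBounds φ) h1)
  · obtain ⟨φ, h1, h2⟩ := exists_memHInfty hF hΨ f
    exact ⟨_, φ, h1, h2, rfl⟩
  · rintro _ ⟨φ, h1, h2, rfl⟩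
    refine le_csInf h1 fun C hC => csInf_le ⟨0, fun C hC => hC.1.le⟩ ⟨hC.1, ?_⟩
    rw [forall_kernels_iff_smul_mem_ball hF hΨ hC.1]
    have := smul_restrict_mem_ball hF hΨ hC
    rwa [show (fun x : F => φ x) = f from funext h2] at this

end Extension
-- Positive kernels with values in the dual of the bounded continuous functions.
section DualKernels
variable {α X : Type*} [Fintype α] [TopologicalSpace X]

open scoped MatrixOrder Matrix.Norms.L2Operator in
/-- A pointwise positive matrix of bounded continuous functions is a sum of positive matrices of
rank one. -/
theorem exists_eq_sum_mul_star {P : α → α → X →ᵇ ℂ}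
    (hP : ∀ ψ, (Matrix.of fun x y => P x y ψ).PosSemidef) :
    ∃ c : α → α → X →ᵇ ℂ, ∀ x y, P x y = ∑ z, c x z * star (c y z) := by
  let M : X → Matrix α α ℂ := fun ψ => Matrix.of fun x y => P x y ψ
  have hM0 : ∀ ψ, 0 ≤ M ψ := fun ψ => (hP ψ).nonneg
  have hMc : Continuous M := continuous_matrix fun x y => (P x y).continuous
  -- The square root depends continuously on the matrix, so its columns give the rank-one terms; its
  -- row `x` has squared length `P x x`, whence boundedness.
  let R : X → Matrix α α ℂ := fun ψ => CFC.sqrt (M ψ)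
  have hRc : Continuous R := CFC.continuousOn_sqrt.comp_continuous hMc hM0
  have hRR : ∀ ψ, R ψ * (R ψ)ᴴ = M ψ := fun ψ => by
    have h1 : (R ψ)ᴴ = R ψ := (CFC.sqrt_nonneg (M ψ)).posSemidef.1
    rw [h1]
    exact CFC.sqrt_mul_sqrt_self (M ψ) (hM0 ψ)
  have hentry : ∀ ψ x y, P x y ψ = ∑ z, R ψ x z * star (R ψ y z) := fun ψ x y => by
    have := congrFun (congrFun (hRR ψ) x) y
    rw [mul_apply] at this
    exact this.symm
  have hbd : ∀ x z ψ, ‖R ψ x z‖ ≤ √‖P x x‖ := fun x z ψ => by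
    refine Real.le_sqrt_of_sq_le ?_
    refine le_trans ?_ ((P x x).norm_coe_le_norm ψ)
    have h1 : P x x ψ = ((∑ z, ‖R ψ x z‖ ^ 2 : ℝ) : ℂ) := by
      rw [hentry]
      push_cast
      refine Finset.sum_congr rfl fun z _ => ?_
      rw [Complex.star_def, mul_comm, ← Complex.normSq_eq_conj_mul_self,
        Complex.normSq_eq_norm_sq]
      push_cast
      rfl
    rw [h1, Complex.norm_real, Real.norm_of_nonneg (by positivity)]
    exact Finset.single_le_sum (f := fun z => ‖R ψ x z‖ ^ 2) (fun _ _ => by positivity)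
      (Finset.mem_univ z)
  refine ⟨fun x z => BoundedContinuousFunction.ofNormedAddCommGroup (fun ψ => R ψ x z)
    (hRc.matrix_elem x z) (√‖P x x‖) (hbd x z), fun x y => ?_⟩
  ext ψ
  rw [hentry, BoundedContinuousFunction.coe_sum, Finset.sum_apply]
  rfl

/-- The definition tests only rank-one matrices over the algebra; pointwise positive ones are finite
sums of these. -/
theorem IsPosDualKernel.sum_nonneg {Γ : α → α → StrongDual ℂ (X →ᵇ ℂ)} (hΓ : IsPosDualKernel Γ)
    {P : α → α → X →ᵇ ℂ} (hP : ∀ ψ, (Matrix.of fun x y => P x y ψ).PosSemidef) :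
    0 ≤ ∑ x, ∑ y, Γ x y (P x y) := by
  obtain ⟨c, hc⟩ := exists_eq_sum_mul_star hP
  have : ∑ x, ∑ y, Γ x y (P x y) = ∑ z, ∑ x, ∑ y, Γ x y (c x z * star (c y z)) := by
    simp only [hc, map_sum]
    rw [Finset.sum_comm]
    rw [Finset.sum_comm (s := (Finset.univ : Finset α)) (t := (Finset.univ : Finset α))
      (f := fun z x => ∑ y, Γ x y (c x z * star (c y z)))]
    rw [Finset.sum_comm]
    exact Finset.sum_congr rfl fun x _ => Finset.sum_comm
  rw [this]
  exact Finset.sum_nonneg fun z _ => hΓ Finset.univ fun x => c x z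

theorem IsPosDualKernel.pair_nonneg {Γ : α → α → StrongDual ℂ (X →ᵇ ℂ)}
    (hΓ : IsPosDualKernel Γ) (x y : α) (a : X →ᵇ ℂ) {c : ℝ} (hc : ‖a‖ ≤ c) :
    0 ≤ (c : ℂ) * (Γ x x 1 + Γ y y 1) + (Γ x y a + Γ y x (star a)) := by
  -- Diagonal entries `c` at `x` and `y` compensate the off-diagonal `a` and `star a`. The sum of
  -- indicators also covers `x = y`.
  let P : α → α → X →ᵇ ℂ := fun i j =>
    (if i = x ∧ j = x then (c : ℂ) • 1 else 0) + (if i = y ∧ j = y then (c : ℂ) • 1 else 0)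
      + (if i = x ∧ j = y then a else 0) + (if i = y ∧ j = x then star a else 0)
  have hsum : ∀ (i₀ j₀ : α) (b : X →ᵇ ℂ),
      ∑ i, ∑ j, Γ i j (if i = i₀ ∧ j = j₀ then b else 0) = Γ i₀ j₀ b := fun i₀ j₀ b => by
    rw [Finset.sum_eq_single i₀, Finset.sum_eq_single j₀]
    · simp
    · intro j _ hj; simp [hj]
    · simp
    · intro i _ hi; simp [hi]
    · simp
  have hP : ∀ ψ, (Matrix.of fun i j => P i j ψ).PosSemidef := fun ψ => by
    have hval : ∀ i j, P i j ψ = (if i = x ∧ j = x then (c : ℂ) else 0)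
        + (if i = y ∧ j = y then (c : ℂ) else 0) + (if i = x ∧ j = y then a ψ else 0)
        + (if i = y ∧ j = x then star (a ψ) else 0) := fun i j => by
      simp only [P, BoundedContinuousFunction.coe_add, Pi.add_apply]
      congr 1
      · congr 1
        · congr 1
          · split_ifs <;> simp
          · split_ifs <;> simp
        · split_ifs <;> simp
      · split_ifs <;> simp
    refine posSemidef_iff_qf.2 ⟨?_, fun v => ?_⟩
    · ext i j
      simp only [conjTranspose_apply, Matrix.of_apply, hval, star_add]
      simp only [apply_ite star, star_zero, Complex.star_def, Complex.conj_ofReal,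
        Complex.conj_conj]
      simp only [and_comm (b := i = _)]
      ring
    · have hdouble : ∀ (i₀ j₀ : α) (b : ℂ), ∑ i, star (v i) *
          ∑ j, (if i = i₀ ∧ j = j₀ then b else 0) * v j = star (v i₀) * (b * v j₀) :=
          fun i₀ j₀ b => by
        rw [Finset.sum_eq_single i₀, Finset.sum_eq_single j₀]
        · simp
        · intro j _ hj; simp [hj]
        · simp
        · intro i _ hi; simp [hi]
        · simp
      have hq : star v ⬝ᵥ (Matrix.of fun i j => P i j ψ) *ᵥ v
          = star (v x) * (c * v x) + star (v y) * (c * v y) + star (v x) * (a ψ * v y)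
            + star (v y) * (star (a ψ) * v x) := by
        simp only [dotProduct, mulVec, Matrix.of_apply, hval, add_mul, Finset.sum_add_distrib,
          mul_add, Pi.star_apply, hdouble]
      have hre : qf (Matrix.of fun i j => P i j ψ) v
          = c * ‖v x‖ ^ 2 + c * ‖v y‖ ^ 2 + 2 * (star (v x) * (a ψ * v y)).re := by
        rw [qf, hq]
        have h1 : ∀ z : ℂ, (star z * (c * z)).re = c * ‖z‖ ^ 2 := fun z => by
          have : star z * (c * z) = ((c * ‖z‖ ^ 2 : ℝ) : ℂ) := by
            rw [mul_left_comm, Complex.star_def, ← Complex.normSq_eq_conj_mul_self,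
              Complex.normSq_eq_norm_sq]
            push_cast
            ring
          rw [this, Complex.ofReal_re]
        have h2 : (star (v y) * (star (a ψ) * v x)).re = (star (v x) * (a ψ * v y)).re := by
          have : star (v y) * (star (a ψ) * v x) = star (star (v x) * (a ψ * v y)) := by
            simp only [star_mul', star_star]
            ring
          rw [this, Complex.star_def, Complex.conj_re]
        simp only [Complex.add_re, h1, h2]
        ring
      rw [hre]
      have h3 : |(star (v x) * (a ψ * v y)).re| ≤ ‖v x‖ * (c * ‖v y‖) := by
        refine (Complex.abs_re_le_norm _).trans ?_
        rw [norm_mul, norm_mul, norm_star]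
        have := (a.norm_coe_le_norm ψ).trans hc
        gcongr
      have hc0 : 0 ≤ c := (norm_nonneg a).trans hc
      have h4 := (abs_le.1 h3).1
      nlinarith [mul_nonneg hc0 (sq_nonneg (‖v x‖ - ‖v y‖))]
  have := hΓ.sum_nonneg hP
  simp only [P, map_add, Finset.sum_add_distrib, hsum, map_smul, smul_eq_mul] at this
  convert this using 1
  ring

/-- Nonnegative complex numbers are real: the imaginary parts of `pair_nonneg` for `a` and `I • a`
give the identity, the diagonal part being real by the case of zero. -/
theorem IsPosDualKernel.star_apply {Γ : α → α → StrongDual ℂ (X →ᵇ ℂ)}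
    (hΓ : IsPosDualKernel Γ) (x y : α) (a : X →ᵇ ℂ) : Γ y x (star a) = star (Γ x y a) := by
  have h0 := hΓ.pair_nonneg x y 0 (c := ‖a‖) (by simp)
  have h1 := hΓ.pair_nonneg x y a le_rfl
  have h2 := hΓ.pair_nonneg x y (Complex.I • a) (c := ‖a‖) (by simp [norm_smul])
  rw [star_smul, map_smul, map_smul] at h2
  simp only [map_zero, star_zero, add_zero] at h0
  have h0' := (Complex.le_def.1 h0).2
  have h1' := (Complex.le_def.1 h1).2
  have h2' := (Complex.le_def.1 h2).2
  simp only [Complex.zero_im, Complex.add_im, smul_eq_mul, Complex.mul_im, Complex.I_re,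
    Complex.I_im, Complex.star_def, Complex.conj_I, Complex.neg_re, Complex.neg_im] at h0' h1' h2'
  refine Complex.ext ?_ ?_
  · simp only [Complex.star_def, Complex.conj_re]
    linarith
  · simp only [Complex.star_def, Complex.conj_im]
    linarith

/-- Rotating `a` so that the off-diagonal terms in `pair_nonneg` become `-2‖Γ x y a‖` bounds them by
the diagonal. -/
theorem IsPosDualKernel.norm_le {Γ : α → α → StrongDual ℂ (X →ᵇ ℂ)}
    (hΓ : IsPosDualKernel Γ) (x y : α) : ‖Γ x y‖ ≤ (Γ x x 1).re + (Γ y y 1).re := by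
  have hnn : 0 ≤ (Γ x x 1).re + (Γ y y 1).re := by
    have := (Complex.le_def.1 (hΓ.pair_nonneg x y 0 (c := 1) (by simp))).1
    simpa using this
  refine ContinuousLinearMap.opNorm_le_bound _ hnn fun a => ?_
  set z := Γ x y a with hz
  by_cases hz0 : z = 0
  · rw [hz0, norm_zero]; positivity
  have hzn : (‖z‖ : ℂ) ≠ 0 := by exact_mod_cast norm_ne_zero_iff.2 hz0
  have h1 := hΓ.pair_nonneg x y ((-(star z / ‖z‖) : ℂ) • a) (c := ‖a‖) (by
    rw [norm_smul, norm_neg, norm_div, norm_star, Complex.norm_real, norm_norm]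
    exact mul_le_of_le_one_left (norm_nonneg _) (div_self_le_one _))
  rw [hΓ.star_apply, map_smul, ← hz] at h1
  have h2 : (-(star z / ‖z‖) : ℂ) • z = ((-‖z‖ : ℝ) : ℂ) := by
    rw [smul_eq_mul, neg_mul, div_mul_eq_mul_div, Complex.star_def,
      ← Complex.normSq_eq_conj_mul_self, Complex.normSq_eq_norm_sq]
    push_cast
    field_simp
  rw [h2] at h1
  have h3 := (Complex.le_def.1 h1).1
  simp only [Complex.zero_re, Complex.add_re, Complex.re_ofReal_mul, Complex.star_def,
    Complex.conj_ofReal, Complex.ofReal_re] at h3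
  have h4 : 0 ≤ ‖z‖ := norm_nonneg _
  nlinarith [mul_nonneg hnn (norm_nonneg a)]

end DualKernels
-- Weighted norms for triangular matrices, and positivity by iteration.
section Weights
variable {n : Type*} [Fintype n]

theorem sq_norm_add_le {η : ℝ} (hη : 0 < η) (x y : ℂ) :
    ‖x + y‖ ^ 2 ≤ (1 + η) * ‖x‖ ^ 2 + (1 + η⁻¹) * ‖y‖ ^ 2 := by
  have h1 : ‖x + y‖ ^ 2 ≤ (‖x‖ + ‖y‖) ^ 2 := by gcongr; exact norm_add_le x y
  have h2 : 0 ≤ η⁻¹ * (η * ‖x‖ - ‖y‖) ^ 2 := by positivity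
  have h3 : η⁻¹ * (η * ‖x‖ - ‖y‖) ^ 2 = η * ‖x‖ ^ 2 - 2 * ‖x‖ * ‖y‖ + η⁻¹ * ‖y‖ ^ 2 := by
    field_simp
    ring
  nlinarith

/-- Uniformly for all triangular matrices with small diagonal and entries bounded by one there is a
weighted norm in which they are strict contractions. -/
theorem exists_weight (h : n → ℕ) {r : ℝ} (hr0 : 0 ≤ r) (hr1 : r < 1) :
    ∃ w : n → ℝ, (∀ i, 1 ≤ w i) ∧ ∀ T : Matrix n n ℂ, (∀ i, ‖T i i‖ ≤ r) →
      (∀ i j, ‖T i j‖ ≤ 1) → (∀ i j, i ≠ j → T i j ≠ 0 → h j < h i) →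
      ∀ v : n → ℂ, ∑ i, w i * ‖(T *ᵥ v) i‖ ^ 2 ≤ (1 + r) / 2 * ∑ i, w i * ‖v i‖ ^ 2 := by
  set N : ℝ := (Fintype.card n : ℝ) with hN
  set η : ℝ := 1 - r with hη
  have hη0 : 0 < η := by linarith
  -- The weights `K ^ (m - h i)` make each off-diagonal step cost a factor `K⁻¹`. This `K` keeps the
  -- total off-diagonal part below `(1 - r)/2`; the diagonal part is at most `(1 + η)r² ≤ r`, and
  -- the sum is `(1 + r)/2`.
  set K : ℝ := 1 + 2 * (1 + η⁻¹) * N ^ 2 / η with hK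
  have hK1 : 1 ≤ K := by
    have : 0 ≤ 2 * (1 + η⁻¹) * N ^ 2 / η := by positivity
    linarith
  have hK0 : 0 < K := by linarith
  set m : ℕ := ∑ i, h i with hm
  have hhm : ∀ i, h i ≤ m := fun i => Finset.single_le_sum (fun _ _ => Nat.zero_le _)
    (Finset.mem_univ i)
  refine ⟨fun i => K ^ (m - h i), fun i => one_le_pow₀ hK1, fun T hdiag hle htri v => ?_⟩
  set w : n → ℝ := fun i => K ^ (m - h i) with hw
  have hw0 : ∀ i, 0 < w i := fun i => by positivity
  have hwK : ∀ i j, h j < h i → w i ≤ K⁻¹ * w j := fun i j hij => by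
    rw [inv_mul_eq_div, le_div_iff₀ hK0, hw]
    simp only
    rw [← pow_succ]
    exact pow_le_pow_right₀ hK1 (by have := hhm i; omega)
  set W : ℝ := ∑ i, w i * ‖v i‖ ^ 2 with hW
  have hW0 : 0 ≤ W := Finset.sum_nonneg fun i _ => mul_nonneg (hw0 i).le (by positivity)
  have hterm : ∀ i, w i * ‖(T *ᵥ v) i‖ ^ 2
      ≤ (1 + η) * r ^ 2 * (w i * ‖v i‖ ^ 2) + (1 + η⁻¹) * (N * (K⁻¹ * W)) := by
    intro i
    have hsplit : (T *ᵥ v) i = T i i * v i + ∑ j ∈ Finset.univ.erase i, T i j * v j := by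
      rw [mulVec, dotProduct]
      exact (Finset.add_sum_erase _ (fun j => T i j * v j) (Finset.mem_univ i)).symm
    set y : ℂ := ∑ j ∈ Finset.univ.erase i, T i j * v j with hy
    have h1 : ‖T i i * v i‖ ^ 2 ≤ r ^ 2 * ‖v i‖ ^ 2 := by
      rw [norm_mul, mul_pow]
      gcongr
      exact hdiag i
    have h2 : ‖y‖ ^ 2 ≤ N * ∑ j ∈ Finset.univ.erase i, ‖T i j * v j‖ ^ 2 := by
      have h3 : ‖y‖ ^ 2 ≤ (∑ j ∈ Finset.univ.erase i, ‖T i j * v j‖) ^ 2 := by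
        gcongr
        exact norm_sum_le _ _
      refine h3.trans (sq_sum_le_card_mul_sum_sq.trans ?_)
      refine mul_le_mul_of_nonneg_right ?_ (Finset.sum_nonneg fun _ _ => by positivity)
      rw [hN]
      exact_mod_cast Finset.card_le_univ _
    have h4 : w i * ∑ j ∈ Finset.univ.erase i, ‖T i j * v j‖ ^ 2 ≤ K⁻¹ * W := by
      rw [Finset.mul_sum, hW, Finset.mul_sum]
      refine (Finset.sum_le_sum fun j hj => ?_).trans
        (Finset.sum_le_sum_of_subset_of_nonneg (Finset.subset_univ _) fun j _ _ =>
          mul_nonneg (by positivity) (mul_nonneg (hw0 j).le (by positivity)))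
      have hji : i ≠ j := (Finset.ne_of_mem_erase hj).symm
      by_cases hT : T i j = 0
      · rw [hT]
        simp only [zero_mul, norm_zero]
        have := hw0 j
        have : (0 : ℝ) ≤ K⁻¹ * (w j * ‖v j‖ ^ 2) := by positivity
        simpa using this
      · rw [← mul_assoc]
        have h5 : ‖T i j * v j‖ ^ 2 ≤ ‖v j‖ ^ 2 := by
          rw [norm_mul]
          gcongr
          exact mul_le_of_le_one_left (norm_nonneg _) (hle i j)
        exact mul_le_mul (hwK i j (htri i j hji hT)) h5 (by positivity)
          (mul_nonneg (by positivity) (hw0 j).le)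
    have h6 := sq_norm_add_le hη0 (T i i * v i) y
    rw [← hsplit] at h6
    have hN0 : 0 ≤ N := by positivity
    calc w i * ‖(T *ᵥ v) i‖ ^ 2
        ≤ w i * ((1 + η) * ‖T i i * v i‖ ^ 2 + (1 + η⁻¹) * ‖y‖ ^ 2) :=
          mul_le_mul_of_nonneg_left h6 (hw0 i).le
      _ ≤ w i * ((1 + η) * (r ^ 2 * ‖v i‖ ^ 2) + (1 + η⁻¹) *
          (N * ∑ j ∈ Finset.univ.erase i, ‖T i j * v j‖ ^ 2)) := by
          refine mul_le_mul_of_nonneg_left ?_ (hw0 i).le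
          gcongr
      _ = (1 + η) * r ^ 2 * (w i * ‖v i‖ ^ 2) + (1 + η⁻¹) *
          (N * (w i * ∑ j ∈ Finset.univ.erase i, ‖T i j * v j‖ ^ 2)) := by ring
      _ ≤ _ := by gcongr
  have hsum := Finset.sum_le_sum fun i (_ : i ∈ Finset.univ) => hterm i
  rw [Finset.sum_add_distrib, ← Finset.mul_sum, Finset.sum_const, Finset.card_univ,
    nsmul_eq_mul, ← hN, ← hW] at hsum
  refine hsum.trans ?_
  have h7 : (1 + η) * r ^ 2 ≤ r := by
    have : r * (1 - (1 + η) * r) = r * (1 - r) ^ 2 := by rw [hη]; ring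
    nlinarith [mul_nonneg hr0 (sq_nonneg (1 - r))]
  have h8 : N * ((1 + η⁻¹) * (N * (K⁻¹ * W))) ≤ (1 - r) / 2 * W := by
    have h9 : (1 + η⁻¹) * N ^ 2 * K⁻¹ ≤ (1 - r) / 2 := by
      rw [mul_inv_le_iff₀ hK0, hK, ← hη]
      have : η / 2 * (1 + 2 * (1 + η⁻¹) * N ^ 2 / η) = η / 2 + (1 + η⁻¹) * N ^ 2 := by
        field_simp
      rw [this]
      linarith
    calc _ = (1 + η⁻¹) * N ^ 2 * K⁻¹ * W := by ring
      _ ≤ _ := mul_le_mul_of_nonneg_right h9 hW0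
  nlinarith [mul_le_mul_of_nonneg_right h7 hW0]

theorem qf_diagonal [DecidableEq n] (w : n → ℝ) (v : n → ℂ) :
    qf (diagonal fun i => (w i : ℂ)) v = ∑ i, w i * ‖v i‖ ^ 2 := by
  simp only [qf, dotProduct, mulVec_diagonal, Pi.star_apply, Complex.re_sum]
  refine Finset.sum_congr rfl fun i _ => ?_
  rw [mul_left_comm, Complex.star_def, ← Complex.normSq_eq_conj_mul_self,
    Complex.normSq_eq_norm_sq, Complex.re_ofReal_mul, Complex.ofReal_re]

theorem abs_qf_le (L : Matrix n n ℂ) (v : n → ℂ) :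
    |qf L v| ≤ (∑ i, ∑ j, ‖L i j‖) * ∑ i, ‖v i‖ ^ 2 := by
  refine (Complex.abs_re_le_norm _).trans ?_
  rw [dotProduct]
  refine (norm_sum_le _ _).trans ?_
  rw [Finset.sum_mul]
  refine Finset.sum_le_sum fun i _ => ?_
  rw [mulVec, dotProduct, Finset.mul_sum, Finset.sum_mul]
  refine (norm_sum_le _ _).trans (Finset.sum_le_sum fun j _ => ?_)
  have hi := Finset.single_le_sum (f := fun i => ‖v i‖ ^ 2) (fun _ _ => by positivity)
    (Finset.mem_univ i)
  have hj := Finset.single_le_sum (f := fun i => ‖v i‖ ^ 2) (fun _ _ => by positivity)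
    (Finset.mem_univ j)
  rw [norm_mul, norm_mul, Pi.star_apply, norm_star]
  have h1 : ‖v i‖ * ‖v j‖ ≤ ∑ i, ‖v i‖ ^ 2 := by
    nlinarith [sq_nonneg (‖v i‖ - ‖v j‖)]
  calc ‖v i‖ * (‖L i j‖ * ‖v j‖) = ‖L i j‖ * (‖v i‖ * ‖v j‖) := by ring
    _ ≤ _ := mul_le_mul_of_nonneg_left h1 (norm_nonneg _)

/-- If a Hermitian form is decreased by a strict contraction, then it is positive. -/
theorem posSemidef_of_sub_conj [DecidableEq n] {L L₀ T : Matrix n n ℂ} {ρ : ℝ}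
    (hρ0 : 0 ≤ ρ) (hρ1 : ρ < 1) (hL₀ : (L₀ - 1).PosSemidef)
    (hT : ((ρ : ℂ) • L₀ - Tᴴ * L₀ * T).PosSemidef) (hL : L.IsHermitian)
    (hLT : (L - Tᴴ * L * T).PosSemidef) : L.PosSemidef := by
  have hcast : ∀ {c : ℝ}, 0 ≤ c → (0 : ℂ) ≤ c := fun hc => by exact_mod_cast hc
  have hL₀' : L₀.PosSemidef := by simpa using hL₀.add PosSemidef.one
  set t : ℝ := ∑ i, ∑ j, ‖L i j‖ with ht
  have ht0 : 0 ≤ t := by positivity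
  have hstart : (L + (t : ℂ) • L₀).PosSemidef := by
    have h1 : (L + (t : ℂ) • 1).PosSemidef := by
      refine posSemidef_iff_qf.2 ⟨hL.add (PosSemidef.one.smul (hcast ht0)).1, fun v => ?_⟩
      rw [qf_add, qf_smul, qf_one]
      have := (abs_le.1 (abs_qf_le L v)).1
      linarith
    have := h1.add (hL₀.smul (hcast ht0))
    convert this using 1
    rw [smul_sub]
    abel
  -- Conjugating by `T` replaces `L` by something smaller and shrinks `L₀` by `ρ`, so the correction
  -- needed to make `L` positive decays geometrically.
  have hpow : ∀ k : ℕ, (L + ((t * ρ ^ k : ℝ) : ℂ) • L₀).PosSemidef := fun k => by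
    induction k with
    | zero => simpa using hstart
    | succ k ih =>
      have hs : 0 ≤ t * ρ ^ k := by positivity
      have := (hLT.add (ih.conjTranspose_mul_mul_same T)).add (hT.smul (hcast hs))
      convert this using 1
      have hmul : ((t * ρ ^ (k + 1) : ℝ) : ℂ) = ((t * ρ ^ k : ℝ) : ℂ) * ρ := by
        push_cast
        ring
      rw [hmul]
      simp only [mul_add, add_mul, Matrix.mul_smul, Matrix.smul_mul, smul_sub, smul_smul]
      abel
  refine posSemidef_of_add_smul (N := L₀) fun ε hε => ?_
  have hlim : Filter.Tendsto (fun k : ℕ => t * ρ ^ k) Filter.atTop (𝓝 0) := by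
    simpa using (tendsto_pow_atTop_nhds_zero_of_lt_one hρ0 hρ1).const_mul t
  obtain ⟨k, hk⟩ := (hlim.eventually (gt_mem_nhds hε)).exists
  have := (hpow k).add (hL₀'.smul (hcast (sub_nonneg.2 hk.le)))
  convert this using 1
  rw [add_assoc, ← add_smul]
  push_cast
  rw [add_sub_cancel]

end Weights

/-! ### Uniform strict contractivity of the test functions. -/

section StrictContraction
variable {G : Type*} [Semigroupoid G] {Ψ : Set (G → ℂ)} {F : Finset G}

theorem IsTestFamily.exists_norm_le_of_isIdem (hΨ : IsTestFamily Ψ) {e : G} (he : IsIdem e) :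
    ∃ r : ℝ, 0 ≤ r ∧ r < 1 ∧ ∀ ψ ∈ Ψ, ‖ψ e‖ ≤ r := by
  have h := Metric.tendstoUniformlyOn_iff.1 (hΨ.tendsto_zero e he) (1 / 2) (by norm_num)
  obtain ⟨n, hn, hn1⟩ := (h.and (Filter.eventually_ge_atTop 1)).exists
  have hn0 : n ≠ 0 := by omega
  -- Uniform convergence gives one exponent `n` with `‖ψ e‖ ^ n < 1/2` for all `ψ`; take the `n`-th
  -- root.
  refine ⟨(1 / 2 : ℝ) ^ (1 / n : ℝ), by positivity,
    Real.rpow_lt_one (by norm_num) (by norm_num) (by positivity), fun ψ hψ => ?_⟩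
  have h1 := hn ψ hψ
  rw [dist_zero_left, norm_pow] at h1
  refine (pow_le_pow_iff_left₀ (norm_nonneg _) (by positivity) hn0).1 ?_
  rw [one_div (n : ℝ), Real.rpow_inv_natCast_pow (by norm_num) hn0]
  exact h1.le

theorem IsTestFamily.exists_norm_le (hΨ : IsTestFamily Ψ) (F : Finset G) :
    ∃ r : ℝ, 0 ≤ r ∧ r < 1 ∧ ∀ e ∈ F, IsIdem e → ∀ ψ ∈ Ψ, ‖ψ e‖ ≤ r := by
  induction F using Finset.induction_on with
  | empty => exact ⟨0, le_rfl, one_pos, by simp⟩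
  | insert a F ha ih =>
    obtain ⟨r, hr0, hr1, hr⟩ := ih
    by_cases hai : IsIdem a
    · obtain ⟨s, hs0, hs1, hs⟩ := hΨ.exists_norm_le_of_isIdem hai
      refine ⟨max r s, hr0.trans (le_max_left _ _), max_lt hr1 hs1, fun e he hei ψ hψ => ?_⟩
      rcases Finset.mem_insert.1 he with rfl | he
      · exact (hs ψ hψ).trans (le_max_right _ _)
      · exact (hr e he hei ψ hψ).trans (le_max_left _ _)
    · refine ⟨r, hr0, hr1, fun e he hei ψ hψ => ?_⟩
      rcases Finset.mem_insert.1 he with rfl | he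
      · exact absurd hei hai
      · exact hr e he hei ψ hψ

/-- On a finite lower set, the test functions act as uniformly strict contractions for a suitable
positive form. -/
theorem IsTestFamily.exists_strict_form (hΨ : IsTestFamily Ψ) (hF : IsLower (F : Set G)) :
    ∃ (L₀ : Matrix F F ℂ) (ρ : ℝ), 0 ≤ ρ ∧ ρ < 1 ∧ (L₀ - 1).PosSemidef ∧ ∀ ψ ∈ Ψ,
      ((ρ : ℂ) • L₀ - (toeplitz fun x : F => ψ x)ᴴ * L₀ *
        toeplitz fun x : F => ψ x).PosSemidef := by
  obtain ⟨r, hr0, hr1, hr⟩ := hΨ.exists_norm_le F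
  -- The number of right divisors strictly increases along proper divisibility, by antisymmetry, so
  -- every Toeplitz matrix is triangular for this height.
  let ht : F → ℕ := fun a => (Finset.univ.filter fun b : F => ∃ c : G, IsProd c b a).card
  obtain ⟨w, hw1, hw⟩ := exists_weight ht hr0 hr1
  have hherm : (diagonal fun i => (w i : ℂ)).IsHermitian := by
    rw [IsHermitian, diagonal_conjTranspose]
    congr 1
    ext i
    simp
  refine ⟨diagonal fun i => (w i : ℂ), (1 + r) / 2, by linarith, by linarith, ?_, ?_⟩
  · refine posSemidef_iff_qf.2 ⟨hherm.sub isHermitian_one, fun v => ?_⟩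
    rw [qf_sub, qf_diagonal, qf_one, sub_nonneg]
    exact Finset.sum_le_sum fun i _ => le_mul_of_one_le_left (by positivity) (hw1 i)
  intro ψ hψ
  set T : Matrix F F ℂ := toeplitz fun x : F => ψ x with hT
  -- An element fixing `a` from the left is idempotent, hence the left unit of `a`; the diagonal
  -- entry is `ψ` at that unit.
  have hdiag : ∀ a, ‖T a a‖ ≤ r := fun a => by
    obtain ⟨e, -, he, -, hea, -⟩ := Semigroupoid.exists_idem (a : G)
    have heF := hF a a.2 e (IsProd.below_left hea)
    have : T a a = ψ e := by
      rw [hT, toeplitz_apply, Finset.sum_eq_single ⟨e, heF⟩]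
      · simp [hea]
      · intro c _ hc
        rw [if_neg]
        intro h
        exact hc (Subtype.ext ((isIdem_of_isProd_self h).left_unique he h hea))
      · simp
    rw [this]
    exact hr e heF he ψ hψ
  have hentry : ∀ a b, ‖T a b‖ ≤ 1 := fun a b => by
    have h1 := (hΨ.posSemidef_one_sub hF hψ).qf_nonneg (Pi.single b 1)
    have h2 := qf_conjTranspose_mul_mul 1 T (Pi.single b 1)
    rw [mul_one] at h2
    rw [qf_sub, h2, qf_one, qf_one, mulVec_single_one] at h1
    have h3 : ∑ i : F, ‖(Pi.single b 1 : F → ℂ) i‖ ^ 2 = 1 := by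
      rw [Finset.sum_eq_single b]
      · simp
      · intro i _ hi
        simp [hi]
      · simp
    have h4 := Finset.single_le_sum (f := fun i : F => ‖T.col b i‖ ^ 2)
      (fun i _ => by positivity) (Finset.mem_univ a)
    simp only [col_apply] at h1 h4
    by_contra! h
    nlinarith
  have htri : ∀ a b, a ≠ b → T a b ≠ 0 → ht b < ht a := fun a b hab hTab => by
    obtain ⟨c, hc⟩ : ∃ c : F, IsProd (c : G) b a := by
      by_contra hcon
      push Not at hcon
      refine hTab ?_
      rw [hT, toeplitz_apply]
      exact Finset.sum_eq_zero fun c _ => if_neg (hcon c)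
    refine Finset.card_lt_card ⟨fun d hd => ?_, fun hsub => ?_⟩
    · simp only [Finset.mem_filter, Finset.mem_univ, true_and] at hd ⊢
      obtain ⟨z, hz⟩ := hd
      obtain ⟨y, -, hy⟩ := (Semigroupoid.assoc (c : G) z d a).2 ⟨b, hz, hc⟩
      exact ⟨y, hy⟩
    · obtain ⟨e, -, -, -, hea, -⟩ := Semigroupoid.exists_idem (a : G)
      have : a ∈ Finset.univ.filter fun d : F => ∃ c : G, IsProd c d b :=
        hsub (by simpa using ⟨e, hea⟩)
      simp only [Finset.mem_filter, Finset.mem_univ, true_and] at this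
      obtain ⟨z, hz⟩ := this
      exact hab (Subtype.ext (eq_of_isProd_of_isProd hc hz))
  refine posSemidef_iff_qf.2 ⟨?_, fun v => ?_⟩
  · refine IsHermitian.sub ?_ (isHermitian_conjTranspose_mul_mul _ hherm)
    rw [IsHermitian, conjTranspose_smul, hherm.eq]
    congr 1
    simp
  · rw [qf_sub, qf_smul, qf_conjTranspose_mul_mul, qf_diagonal, qf_diagonal, sub_nonneg]
    exact hw T hdiag hentry htri v

end StrictContraction
-- Duality between the cone of forms and the dual kernels.
section DualCone
variable {G : Type*} [Semigroupoid G] {Ψ : Set (G → ℂ)} (hΨ : IsTestFamily Ψ) {F : Finset G}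

/-- The kernel `[1] - EE*` on `F`. -/
noncomputable def gapKer (F : Finset G) (p q : F) : Ψ →ᵇ ℂ :=
  unitKer (p : G) (q : G) • (1 : Ψ →ᵇ ℂ) - evalE hΨ (p : G) * star (evalE hΨ (q : G))

/-- The coefficients of `[1] - EE*` as a multiplier of kernels. -/
noncomputable def gapCoeff (x y q s : F) : Ψ →ᵇ ℂ :=
  ∑ p : F, ∑ r : F, if IsProd (p : G) q x ∧ IsProd (r : G) s y then gapKer hΨ F p r else 0

theorem starHat_gapKer (Γ : F → F → StrongDual ℂ (Ψ →ᵇ ℂ)) (x y : F) :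
    starHat Γ (gapKer hΨ F) x y = ∑ q, ∑ s, Γ q s (gapCoeff hΨ x y q s) := by
  simp only [starHat, sum_factorizations, gapCoeff, map_sum]
  refine Finset.sum_congr rfl fun q _ => ?_
  rw [Finset.sum_comm (s := (Finset.univ : Finset F)) (t := (Finset.univ : Finset F))
    (f := fun s p => ∑ r : F, Γ q s (if IsProd (p : G) q x ∧ IsProd (r : G) s y
      then gapKer hΨ F p r else 0))]
  refine Finset.sum_congr rfl fun p _ => ?_
  by_cases h : IsProd (p : G) q x
  · simp only [h, if_true, true_and]
    refine Finset.sum_congr rfl fun s _ => Finset.sum_congr rfl fun r _ => ?_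
    split_ifs <;> simp
  · simp [h]

theorem gapKer_apply (p r : F) (ψ : Ψ) : gapKer hΨ F p r ψ =
    delta (p : G) * star (delta (r : G)) - (ψ : G → ℂ) p * star ((ψ : G → ℂ) r) := by
  rw [← unitKer_eq]
  simp [gapKer, evalE]

theorem gapCoeff_apply (hF : IsLower (F : Set G)) (x y q s : F) (ψ : Ψ) :
    gapCoeff hΨ x y q s ψ = (1 : Matrix F F ℂ) x q * star ((1 : Matrix F F ℂ) y s)
      - toeplitz (fun z : F => (ψ : G → ℂ) z) x q *
        star (toeplitz (fun z : F => (ψ : G → ℂ) z) y s) := by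
  have hprod : ∀ φ : F → ℂ, toeplitz φ x q * star (toeplitz φ y s) = ∑ p : F, ∑ r : F,
      if IsProd (p : G) q x ∧ IsProd (r : G) s y then φ p * star (φ r) else 0 := fun φ => by
    rw [toeplitz_apply, toeplitz_apply, star_sum, Finset.sum_mul_sum]
    refine Finset.sum_congr rfl fun p _ => Finset.sum_congr rfl fun r _ => ?_
    by_cases h1 : IsProd (p : G) q x <;> by_cases h2 : IsProd (r : G) s y <;> simp [h1, h2]
  rw [← toeplitz_delta hF, hprod, hprod, ← Finset.sum_sub_distrib, gapCoeff,
    BoundedContinuousFunction.coe_sum, Finset.sum_apply]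
  refine Finset.sum_congr rfl fun p _ => ?_
  rw [← Finset.sum_sub_distrib, BoundedContinuousFunction.coe_sum, Finset.sum_apply]
  refine Finset.sum_congr rfl fun r _ => ?_
  split_ifs
  · exact gapKer_apply hΨ p r ψ
  · simp

theorem star_gapCoeff (hF : IsLower (F : Set G)) (x y q s : F) :
    star (gapCoeff hΨ x y q s) = gapCoeff hΨ y x s q := by
  ext ψ
  rw [BoundedContinuousFunction.star_apply, gapCoeff_apply hΨ hF, gapCoeff_apply hΨ hF, star_sub,
    star_mul', star_mul', star_star, star_star, mul_comm (star _), mul_comm (star _)]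

/-- The matrix over `C_b(Ψ)` dual to `L` under the trace pairing. -/
noncomputable def gapForm (L : Matrix F F ℂ) (q s : F) : Ψ →ᵇ ℂ :=
  ∑ x, ∑ y, L y x • gapCoeff hΨ x y q s

theorem gapForm_apply (hF : IsLower (F : Set G)) (L : Matrix F F ℂ) (q s : F) (ψ : Ψ) :
    gapForm hΨ L q s ψ = (L - (toeplitz fun z : F => (ψ : G → ℂ) z)ᴴ * L *
      toeplitz fun z : F => (ψ : G → ℂ) z) s q := by
  have h : ∀ A : Matrix F F ℂ,
      (Aᴴ * L * A) s q = ∑ x, ∑ y, L y x * (A x q * star (A y s)) := fun A => by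
    rw [mul_apply]
    refine Finset.sum_congr rfl fun x _ => ?_
    rw [mul_apply, Finset.sum_mul]
    refine Finset.sum_congr rfl fun y _ => ?_
    rw [conjTranspose_apply]
    ring
  have h1 := h 1
  rw [conjTranspose_one, Matrix.one_mul, Matrix.mul_one] at h1
  rw [Matrix.sub_apply, h, h1, gapForm, ← Finset.sum_sub_distrib,
    BoundedContinuousFunction.coe_sum, Finset.sum_apply]
  refine Finset.sum_congr rfl fun x _ => ?_
  rw [← Finset.sum_sub_distrib, BoundedContinuousFunction.coe_sum, Finset.sum_apply]
  refine Finset.sum_congr rfl fun y _ => ?_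
  rw [BoundedContinuousFunction.smul_apply, gapCoeff_apply hΨ hF, smul_eq_mul, mul_sub]

theorem of_gapForm_apply (hF : IsLower (F : Set G)) (L : Matrix F F ℂ) (ψ : Ψ) :
    (Matrix.of fun q s => gapForm hΨ L q s ψ) = (L - (toeplitz fun z : F => (ψ : G → ℂ) z)ᴴ * L *
      toeplitz fun z : F => (ψ : G → ℂ) z)ᵀ :=
  Matrix.ext fun q s => gapForm_apply hΨ hF L q s ψ

/-- The trace pairing moves the multiplier `[1] - EE*` from `Γ` onto `L`, where it becomes the
pointwise inequality defining the cone. -/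
theorem trace_mul_starHat (L : Matrix F F ℂ) (Γ : F → F → StrongDual ℂ (Ψ →ᵇ ℂ)) :
    (L * Matrix.of (starHat Γ (gapKer hΨ F))).trace = ∑ q, ∑ s, Γ q s (gapForm hΨ L q s) := by
  have hcomm : ∀ φ : F → F → F → F → ℂ,
      ∑ y, ∑ x, ∑ q, ∑ s, φ y x q s = ∑ q, ∑ s, ∑ x, ∑ y, φ y x q s := fun φ => by
    rw [Finset.sum_comm]
    rw [← Fintype.sum_prod_type' (f := fun x y => ∑ q, ∑ s, φ y x q s),
      ← Fintype.sum_prod_type' (f := fun q s => ∑ x, ∑ y, φ y x q s)]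
    simp only [← Fintype.sum_prod_type' (f := fun q s => φ _ _ q s),
      ← Fintype.sum_prod_type' (f := fun x y => φ y x _ _)]
    exact Finset.sum_comm
  simp only [trace, diag_apply, mul_apply, Matrix.of_apply, starHat_gapKer, Finset.mul_sum,
    gapForm, map_sum, map_smul, smul_eq_mul]
  exact hcomm fun y x q s => L y x * Γ q s (gapCoeff hΨ x y q s)

/-- The matrices `Γ ⋆̂ ([1] - EE*)` with `Γ` positive. -/
def dualCone (F : Finset G) : Set (Matrix F F ℂ) :=
  {M | ∃ Γ : F → F → StrongDual ℂ (Ψ →ᵇ ℂ), IsPosDualKernel Γ ∧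
    M = Matrix.of (starHat Γ (gapKer hΨ F))}

theorem trace_nonneg_of_mem_dualCone (hF : IsLower (F : Set G)) {L M : Matrix F F ℂ}
    (hL : L ∈ (lowerAlg F hF).cone (testSet Ψ F)) (hM : M ∈ dualCone hΨ F) :
    0 ≤ (L * M).trace.re := by
  obtain ⟨Γ, hΓ, rfl⟩ := hM
  rw [trace_mul_starHat]
  refine (Complex.le_def.1 (hΓ.sum_nonneg fun ψ => ?_)).1
  rw [of_gapForm_apply hΨ hF]
  exact (((mem_cone_iff hF).1 hL).2 ψ ψ.2).transpose

theorem isHermitian_of_mem_dualCone (hF : IsLower (F : Set G)) {M : Matrix F F ℂ}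
    (hM : M ∈ dualCone hΨ F) : M.IsHermitian := by
  obtain ⟨Γ, hΓ, rfl⟩ := hM
  ext x y
  rw [conjTranspose_apply, Matrix.of_apply, Matrix.of_apply, starHat_gapKer, starHat_gapKer,
    star_sum, Finset.sum_comm]
  simp only [star_sum]
  rw [Finset.sum_comm]
  rw [Finset.sum_comm]
  refine Finset.sum_congr rfl fun q _ => Finset.sum_congr rfl fun s _ => ?_
  rw [← hΓ.star_apply, star_gapCoeff hΨ hF]

theorem combination_mem_dualCone {M N : Matrix F F ℂ} (hM : M ∈ dualCone hΨ F)
    (hN : N ∈ dualCone hΨ F) {a b : ℝ} (ha : 0 ≤ a) (hb : 0 ≤ b) :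
    a • M + b • N ∈ dualCone hΨ F := by
  obtain ⟨Γ, hΓ, rfl⟩ := hM
  obtain ⟨Δ, hΔ, rfl⟩ := hN
  refine ⟨fun x y => (a : ℂ) • Γ x y + (b : ℂ) • Δ x y, fun A f => ?_, ?_⟩
  · have h1 : (0 : ℂ) ≤ a := by exact_mod_cast ha
    have h2 : (0 : ℂ) ≤ b := by exact_mod_cast hb
    have := add_nonneg (mul_nonneg h1 (hΓ A f)) (mul_nonneg h2 (hΔ A f))
    refine this.trans_eq ?_
    simp only [Finset.mul_sum, ← Finset.sum_add_distrib]
    rfl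
  · ext x y
    simp only [Matrix.add_apply, Matrix.smul_apply, Matrix.of_apply, starHat_gapKer,
      Complex.real_smul, Finset.mul_sum, ← Finset.sum_add_distrib]
    rfl

theorem convex_dualCone : Convex ℝ (dualCone hΨ F) :=
  fun _ hM _ hN _ _ ha hb _ => combination_mem_dualCone hΨ hM hN ha hb

theorem zero_mem_dualCone : 0 ∈ dualCone hΨ F :=
  ⟨0, fun A f => by simp, by ext x y; simp [starHat_gapKer]⟩

/-- The diagonal of `Γ` is controlled by `Γ ⋆̂ ([1] - EE*)`. -/
theorem exists_norm_le_trace (hF : IsLower (F : Set G)) :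
    ∃ (L : Matrix F F ℂ) (c : ℝ), ∀ Γ : F → F → StrongDual ℂ (Ψ →ᵇ ℂ), IsPosDualKernel Γ →
      ∀ x y, ‖Γ x y‖ ≤ c * (L * Matrix.of (starHat Γ (gapKer hΨ F))).trace.re := by
  obtain ⟨L, ρ, hρ0, hρ1, hL1, hL⟩ := hΨ.exists_strict_form hF
  have hρ : 0 < 1 - ρ := sub_pos.2 hρ1
  refine ⟨L, 2 * (1 - ρ)⁻¹, fun Γ hΓ x y => ?_⟩
  have hdiag : ∀ z, 0 ≤ (Γ z z 1).re := fun z => by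
    have := (Complex.le_def.1 (hΓ.pair_nonneg z z 0 (c := 1) (by simp))).1
    simp only [Complex.ofReal_one, one_mul, map_zero, star_zero, add_zero, Complex.zero_re,
      Complex.add_re] at this
    linarith
  have hsum : (1 - ρ) * ∑ z, (Γ z z 1).re
      ≤ (L * Matrix.of (starHat Γ (gapKer hΨ F))).trace.re := by
    -- Pointwise this is the transpose of `(ρL - T*LT) + (1 - ρ)(L - 1)`, a sum of positive
    -- matrices; applying `Γ` bounds its diagonal by the trace.
    have h := hΓ.sum_nonneg (P := fun q s => gapForm hΨ L q s -
      if q = s then ((1 - ρ : ℝ) : ℂ) • 1 else 0) fun ψ => by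
        have h1 : (0 : ℂ) ≤ ((1 - ρ : ℝ) : ℂ) := by exact_mod_cast hρ.le
        refine (congrArg PosSemidef ?_).mp ((hL ψ ψ.2).add (hL1.smul h1)).transpose
        symm
        refine Matrix.ext fun q s => ?_
        have h2 : (if q = s then ((1 - ρ : ℝ) : ℂ) • (1 : Ψ →ᵇ ℂ) else 0) ψ
            = ((1 - ρ : ℝ) : ℂ) * (1 : Matrix F F ℂ) s q := by
          by_cases hqs : q = s
          · subst hqs
            simp
          · simp [hqs, one_apply_ne (Ne.symm hqs)]
        rw [Matrix.of_apply, BoundedContinuousFunction.coe_sub, Pi.sub_apply, h2,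
          gapForm_apply hΨ hF]
        simp only [transpose_apply, Matrix.add_apply, Matrix.sub_apply, Matrix.smul_apply,
          smul_eq_mul]
        push_cast
        ring
    have h' := (Complex.le_def.1 h).1
    simp only [map_sub, Finset.sum_sub_distrib] at h'
    rw [← trace_mul_starHat] at h'
    have h3 : ∑ q, ∑ s, Γ q s (if q = s then ((1 - ρ : ℝ) : ℂ) • 1 else 0)
        = ((1 - ρ : ℝ) : ℂ) * ∑ q, Γ q q 1 := by
      rw [Finset.mul_sum]
      refine Finset.sum_congr rfl fun q _ => ?_
      rw [Finset.sum_eq_single q]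
      · simp
      · intro s _ hs
        simp [Ne.symm hs]
      · simp
    rw [h3, Complex.sub_re, Complex.re_ofReal_mul, Complex.re_sum, Complex.zero_re] at h'
    linarith
  have hx := Finset.single_le_sum (fun z _ => hdiag z) (Finset.mem_univ x)
  have hy := Finset.single_le_sum (fun z _ => hdiag z) (Finset.mem_univ y)
  refine (hΓ.norm_le x y).trans ?_
  rw [mul_assoc, inv_mul_eq_div]
  have := (le_div_iff₀' hρ).2 hsum
  linarith

omit [Semigroupoid G] in
theorem isCompact_posDualKernel (R : ℝ) : IsCompact {Γ : F → F → WeakDual ℂ (Ψ →ᵇ ℂ) |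
    (∀ x y, ‖WeakDual.toStrongDual (Γ x y)‖ ≤ R) ∧
      IsPosDualKernel fun x y => WeakDual.toStrongDual (Γ x y)} := by
  have h1 : IsCompact (Set.univ.pi fun _ : F => Set.univ.pi fun _ : F =>
      WeakDual.toStrongDual ⁻¹' Metric.closedBall (0 : StrongDual ℂ (Ψ →ᵇ ℂ)) R) :=
    isCompact_univ_pi fun _ => isCompact_univ_pi fun _ => WeakDual.isCompact_closedBall _ _
  have h2 : IsClosed {Γ : F → F → WeakDual ℂ (Ψ →ᵇ ℂ) |
      IsPosDualKernel fun x y => WeakDual.toStrongDual (Γ x y)} := by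
    simp only [IsPosDualKernel, Set.ofPred_forall]
    refine isClosed_iInter fun A => isClosed_iInter fun f => isClosed_le continuous_const ?_
    refine continuous_finsetSum _ fun x _ => continuous_finsetSum _ fun y _ => ?_
    exact (WeakDual.eval_continuous _).comp ((continuous_apply y).comp (continuous_apply x))
  convert h1.inter_right h2 using 1
  ext Γ
  simp [Set.mem_pi]

/-- Near a limit point the representing `Γ` are bounded in norm by `exists_norm_le_trace`, so they
range in a weak-* compact set whose continuous image is closed. -/
theorem isClosed_dualCone (hF : IsLower (F : Set G)) : IsClosed (dualCone hΨ F) := by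
  obtain ⟨L, c, hLc⟩ := exists_norm_le_trace hΨ hF
  refine isClosed_of_closure_subset fun M hM => ?_
  let Θ : (F → F → WeakDual ℂ (Ψ →ᵇ ℂ)) → Matrix F F ℂ := fun Γ =>
    Matrix.of (starHat (fun x y => WeakDual.toStrongDual (Γ x y)) (gapKer hΨ F))
  have hΘ : Continuous Θ := continuous_matrix fun x y => by
    simp only [Θ, Matrix.of_apply, starHat_gapKer]
    refine continuous_finsetSum _ fun q _ => continuous_finsetSum _ fun s _ => ?_
    exact (WeakDual.eval_continuous _).comp ((continuous_apply s).comp (continuous_apply q))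
  have hopen : IsOpen {X : Matrix F F ℂ |
      c * (L * X).trace.re < c * (L * M).trace.re + 1} := by
    refine isOpen_lt ?_ continuous_const
    exact continuous_const.mul (Complex.continuous_re.comp
      (continuous_const.matrix_mul continuous_id).matrix_trace)
  have hMU := hopen.inter_closure ⟨by simp, hM⟩
  have hK := (isCompact_posDualKernel (Ψ := Ψ) (F := F) (c * (L * M).trace.re + 1)).image hΘ
  have hsub : {X : Matrix F F ℂ | c * (L * X).trace.re < c * (L * M).trace.re + 1} ∩
      dualCone hΨ F ⊆ Θ '' {Γ | (∀ x y, ‖WeakDual.toStrongDual (Γ x y)‖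
        ≤ c * (L * M).trace.re + 1) ∧
          IsPosDualKernel fun x y => WeakDual.toStrongDual (Γ x y)} := by
    rintro _ ⟨hX, Γ, hΓ, rfl⟩
    exact ⟨fun x y => StrongDual.toWeakDual (Γ x y),
      ⟨fun x y => (hLc Γ hΓ x y).trans (le_of_lt hX), hΓ⟩, rfl⟩
  obtain ⟨Γ, hΓ, rfl⟩ := closure_minimal hsub hK.isClosed hMU
  exact ⟨_, hΓ.2, rfl⟩

/-- The dual kernels supported at a single test function. -/
theorem isPosDualKernel_eval {α X : Type*} [TopologicalSpace X] (ψ : X) (g : α → ℂ) :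
    IsPosDualKernel fun x y => (g x * star (g y)) •
      (BoundedContinuousFunction.evalCLM ℂ ψ : (X →ᵇ ℂ) →L[ℂ] ℂ) := by
  intro A f
  have : ∑ x ∈ A, ∑ y ∈ A, ((g x * star (g y)) •
      (BoundedContinuousFunction.evalCLM ℂ ψ : (X →ᵇ ℂ) →L[ℂ] ℂ)) (f x * star (f y))
      = (∑ x ∈ A, g x * f x ψ) * star (∑ x ∈ A, g x * f x ψ) := by
    rw [star_sum, Finset.sum_mul_sum]
    refine Finset.sum_congr rfl fun x _ => Finset.sum_congr rfl fun y _ => ?_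
    simp
    ring
  rw [this]
  exact mul_star_self_nonneg _

/-- Testing `H` on evaluation at `ψ` weighted by `g` isolates the inequality of a single test
function. -/
theorem qf_le_zero_of_forall_trace_le (hF : IsLower (F : Set G)) {H : Matrix F F ℂ}
    (hH : ∀ X ∈ dualCone hΨ F, (H * X).trace.re ≤ 0) {ψ : G → ℂ} (hψ : ψ ∈ Ψ) (g : F → ℂ) :
    qf (H - (toeplitz fun z : F => ψ z)ᴴ * H * toeplitz fun z : F => ψ z) g ≤ 0 := by
  have h := hH _ ⟨_, isPosDualKernel_eval (⟨ψ, hψ⟩ : Ψ) g, rfl⟩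
  rw [trace_mul_starHat] at h
  convert h using 1
  rw [qf]
  congr 1
  simp only [dotProduct, mulVec, Finset.mul_sum]
  rw [Finset.sum_comm]
  refine Finset.sum_congr rfl fun q _ => Finset.sum_congr rfl fun s _ => ?_
  rw [_root_.smul_apply, BoundedContinuousFunction.evalCLM_apply, gapForm_apply hΨ hF,
    smul_eq_mul, Pi.star_apply]
  ring

theorem mem_dualCone_of_forall_trace_nonneg (hne : Ψ.Nonempty) (hF : IsLower (F : Set G))
    {M : Matrix F F ℂ} (hMh : M.IsHermitian)
    (hM : ∀ L ∈ (lowerAlg F hF).cone (testSet Ψ F), 0 ≤ (L * M).trace.re) :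
    M ∈ dualCone hΨ F := by
  by_contra hcon
  obtain ⟨H, u, hH, h1, h2⟩ := exists_isHermitian_separating (convex_dualCone hΨ)
    (isClosed_dualCone hΨ hF) (fun X hX => isHermitian_of_mem_dualCone hΨ hF hX) hMh hcon
  have hu : 0 < u := by simpa using h1 0 (zero_mem_dualCone hΨ)
  -- A functional bounded above on a cone is nonpositive there: a positive value could be scaled up
  -- to `u`.
  have hle : ∀ X ∈ dualCone hΨ F, (H * X).trace.re ≤ 0 := fun X hX => by
    by_contra! hpos
    have h3 := h1 _ (combination_mem_dualCone hΨ hX hX (a := u / (H * X).trace.re) (b := 0)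
      (by positivity) le_rfl)
    rw [zero_smul, add_zero, Matrix.mul_smul, trace_smul, Complex.smul_re, smul_eq_mul,
      div_mul_cancel₀ _ hpos.ne'] at h3
    exact lt_irrefl _ h3
  have hdiff : ∀ ψ ∈ Ψ, (-H - (toeplitz fun z : F => ψ z)ᴴ * -H *
      toeplitz fun z : F => ψ z).PosSemidef := fun ψ hψ => by
    refine posSemidef_iff_qf.2 ⟨hH.neg.sub (isHermitian_conjTranspose_mul_mul _ hH.neg),
      fun v => ?_⟩
    have h3 := qf_le_zero_of_forall_trace_le hΨ hF hle hψ v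
    rw [qf_sub, qf_conjTranspose_mul_mul] at h3 ⊢
    simp only [qf, neg_mulVec, dotProduct_neg, Complex.neg_re] at h3 ⊢
    linarith
  -- Separation does not make `-H` positive; this follows from its decrease under one strict
  -- contraction.
  obtain ⟨ψ₀, hψ₀⟩ := hne
  obtain ⟨L₀, ρ, hρ0, hρ1, hL₀, hT⟩ := hΨ.exists_strict_form hF
  have h4 := hM (-H) ((mem_cone_iff hF).2
    ⟨posSemidef_of_sub_conj hρ0 hρ1 hL₀ (hT ψ₀ hψ₀) hH.neg (hdiff ψ₀ hψ₀), hdiff⟩)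
  rw [Matrix.neg_mul, trace_neg, Complex.neg_re] at h4
  linarith

/-- For `M = δδ* - ff*` the pairing with `L` is `L(δ) - L(f)`, so the ball condition says that `M`
is in the polar of the cone. -/
theorem exists_dualKernel_iff_mem_ball (hne : Ψ.Nonempty) (hF : IsLower (F : Set G))
    {f : F → ℂ} :
    (∃ Γ : F → F → StrongDual ℂ (Ψ →ᵇ ℂ), IsPosDualKernel Γ ∧ ∀ x y : F,
      unitKer (x : G) (y : G) - f x * star (f y) = starHat Γ (gapKer hΨ F) x y) ↔
      f ∈ (lowerAlg F hF).ball (testSet Ψ F) := by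
  set δ : F → ℂ := (lowerAlg F hF).unit with hδ
  set M : Matrix F F ℂ := vecMulVec δ (star δ) - vecMulVec f (star f) with hM
  have hMapply : ∀ x y : F, M x y = unitKer (x : G) (y : G) - f x * star (f y) := fun x y => by
    rw [unitKer_eq]
    rfl
  have hmem : (∃ Γ : F → F → StrongDual ℂ (Ψ →ᵇ ℂ), IsPosDualKernel Γ ∧ ∀ x y : F,
      unitKer (x : G) (y : G) - f x * star (f y) = starHat Γ (gapKer hΨ F) x y) ↔
      M ∈ dualCone hΨ F := by
    refine exists_congr fun Γ => and_congr_right fun _ => ?_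
    simp only [← hMapply]
    exact ⟨fun h => Matrix.ext h, fun h x y => congrFun (congrFun h x) y⟩
  have htrace : ∀ L : Matrix F F ℂ, (L * M).trace.re = qf L δ - qf L f := fun L => by
    rw [hM, Matrix.mul_sub, trace_sub, trace_mul_vecMulVec, trace_mul_vecMulVec, Complex.sub_re]
    rfl
  have hMh : M.IsHermitian := by
    ext x y
    simp [hM, vecMulVec_apply, mul_comm]
  rw [hmem]
  refine ⟨fun h L hL => ?_, fun h => ?_⟩
  · have := trace_nonneg_of_mem_dualCone hΨ hF hL h
    rw [htrace] at this
    linarith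
  · refine mem_dualCone_of_forall_trace_nonneg hΨ hne hF hMh fun L hL => ?_
    rw [htrace]
    linarith [h L hL]

end DualCone
end AglerJury

/-! ### The interpolation theorem. -/

theorem theorem1 {G : Type*} [Semigroupoid G] {Ψ : Set (G → ℂ)} (hΨ : IsTestFamily Ψ)
    (hne : Ψ.Nonempty) (F : Finset G) (hF : IsLower (F : Set G)) (f : F → ℂ) :
    List.TFAE [
      ∃ φ : G → ℂ, MemHInfty Ψ φ ∧ hInftyNorm Ψ φ ≤ 1 ∧ ∀ x : F, φ x = f x,
      ∀ k ∈ kernels Ψ, IsPosKernel (starProd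
        (fun p q : F => unitKer (p : G) (q : G) - f p * star (f q))
        (fun p q : F => k p q)),
      ∃ Γ : F → F → StrongDual ℂ (Ψ →ᵇ ℂ), IsPosDualKernel Γ ∧ ∀ x y : F,
        unitKer (x : G) (y : G) - f x * star (f y) =
          starHat Γ (fun p q : F => unitKer (p : G) (q : G) • (1 : Ψ →ᵇ ℂ) -
            evalE hΨ (p : G) * star (evalE hΨ (q : G))) x y] ∧
    (∃ φ : G → ℂ, MemHInfty Ψ φ ∧ ∀ x : F, φ x = f x) ∧
    quotientNorm Ψ F f = kernelNorm Ψ F f := by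
  classical
  have h1 := exists_memHInfty_iff_mem_ball hF hΨ (f := f)
  have h2 := forall_kernels_iff_mem_ball hF hΨ (f := f)
  have h3 := exists_dualKernel_iff_mem_ball hΨ hne hF (f := f)
  refine ⟨?_, exists_memHInfty hF hΨ f, quotientNorm_eq_kernelNorm hF hΨ f⟩
  tfae_have 1 ↔ 2 := h1.trans h2.symm
  tfae_have 2 ↔ 3 := h2.trans h3.symm
  tfae_finish
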